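/- Let $\mathbb{T}=\{z\in\mathbb{C} : |z|=1\}$ and let $\mathcal{Q}_{\mathbb{T}}$ be the field of meromorphic functions on $\mathbb{T}$, i.e. of meromorphic functions on connected open neighbourhoods of $\mathbb{T}$ in $\mathbb{C}$, two of them being identified if they agree on some connected open neighbourhood of $\mathbb{T}$. For $g(\lambda)\in\mathcal{Q}_{\mathbb{T}}[\lambda]$ and $z\in\mathbb{T}$ at which no coefficient of $g$ has a pole, let $g(\lambda;z)\in\mathbb{C}[\lambda]$ be the polynomial obtained by evaluating the coefficients at $z$. Let $g(\lambda)\in\mathcal{Q}_{\mathbb{T}}[\lambda]$ be a monic irreducible polynomial of degree $d$. Assume that for every $z\in\mathbb{T}$ at which no coefficient of $g$ has a pole, all the roots of $g(\lambda;z)$ in $\mathbb{C}$ are elements of $\mathbb{T}$. Then: 1. There exists a function $\lambda(\cdot)$, analytic on a neighbourhood of $\mathbb{T}$, such that for every $z\in\mathbb{T}$ no coefficient of $g$ has a pole at $z$ and $$g(\lambda;z)=\prod_{\zeta\,:\,\zeta^d=z}\bigl(\lambda-\lambda(\zeta)\bigr).$$ 2. If $\lambda(\cdot)$ and $\widetilde\lambda(\cdot)$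 are two functions, analytic on neighbourhoods of $\mathbb{T}$, which both satisfy this identity for every $z\in\mathbb{T}$, then there exists $c\in\{0,1,\dots,d-1\}$ such that $$\widetilde\lambda(\zeta)=\lambda\bigl(e^{2\pi i c/d}\zeta\bigr)\qquad\text{for every }\zeta\in\mathbb{T}.$$ -/

import Mathlib

open Filter Topology

namespace MeroCircle

/-- The filter of punctured neighbourhoods of the unit circle: a set belongs to it iff it contains
a punctured neighbourhood of every point of the circle. -/
noncomputable def puncturedNhds : Filter ℂ := ⨆ z : Circle, 𝓝[≠] (z : ℂ)

/-- Being equal along `puncturedNhds` means being equal in a punctured neighbourhood of every point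
of the unit circle (so, by compactness, off a finite set, in a neighbourhood of the circle). -/
theorem eventually_iff {P : ℂ → Prop} :
    (∀ᶠ w in puncturedNhds, P w) ↔ ∀ z : Circle, ∀ᶠ w in 𝓝[≠] (z : ℂ), P w := by
  simp [puncturedNhds]

theorem le_puncturedNhds (z : Circle) : 𝓝[≠] (z : ℂ) ≤ puncturedNhds :=
  le_iSup (fun z : Circle => 𝓝[≠] (z : ℂ)) z

/-- The meromorphic functions on the unit circle: germs along the circle of functions which are
meromorphic at every point of the circle (hence on a connected open neighbourhood of it, an
annulus). Two functions are identified when they agree near the circle up to isolated points, i.e.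
when they define the same analytic map to the Riemann sphere near the circle. Sums and products
are pointwise. -/
noncomputable def subring : Subring (Germ puncturedNhds ℂ) where
  carrier := {q | ∃ f : ℂ → ℂ, MeromorphicOn f (Metric.sphere 0 1) ∧ (f : Germ puncturedNhds ℂ) = q}
  mul_mem' := by
    rintro _ _ ⟨f, hf, rfl⟩ ⟨g, hg, rfl⟩
    exact ⟨f * g, hf.mul hg, rfl⟩
  one_mem' := ⟨1, MeromorphicOn.const 1, rfl⟩
  add_mem' := by
    rintro _ _ ⟨f, hf, rfl⟩ ⟨g, hg, rfl⟩
    exact ⟨f + g, hf.add hg, rfl⟩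
  zero_mem' := ⟨0, MeromorphicOn.const 0, rfl⟩
  neg_mem' := by
    rintro _ ⟨f, hf, rfl⟩
    exact ⟨-f, hf.neg, rfl⟩

theorem inv_mem {q : Germ puncturedNhds ℂ} (hq : q ∈ subring) : q⁻¹ ∈ subring := by
  obtain ⟨f, hf, rfl⟩ := hq
  exact ⟨f⁻¹, hf.inv, rfl⟩

theorem coe_mem_sphere (z : Circle) : (z : ℂ) ∈ Metric.sphere (0 : ℂ) 1 := by
  simp [Circle.norm_coe]

theorem isPreconnected_sphere : IsPreconnected (Metric.sphere (0 : ℂ) 1) :=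
  _root_.isPreconnected_sphere (by simp [Complex.rank_real_complex]) 0 1

theorem mul_inv_cancel {q : Germ puncturedNhds ℂ} (hq : q ∈ subring) (h0 : q ≠ 0) :
    q * q⁻¹ = 1 := by
  obtain ⟨f, hf, rfl⟩ := hq
  have key : ∀ z : Circle, ∀ᶠ w in 𝓝[≠] (z : ℂ), f w ≠ 0 := by
    by_contra! h
    obtain ⟨z, hz⟩ := h
    apply h0
    refine Germ.coe_eq.mpr (eventually_iff.mpr fun x => ?_)
    have hzt : meromorphicOrderAt f (z : ℂ) = ⊤ := by
      by_contra h'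
      exact hz ((meromorphicOrderAt_ne_top_iff_eventually_ne_zero (hf _ (coe_mem_sphere z))).mp h')
    have hxt : meromorphicOrderAt f (x : ℂ) = ⊤ := by
      by_contra h'
      exact hf.meromorphicOrderAt_ne_top_of_isPreconnected isPreconnected_sphere
        (coe_mem_sphere x) (coe_mem_sphere z) h' hzt
    exact meromorphicOrderAt_eq_top_iff.mp hxt
  refine Germ.coe_eq.mpr (eventually_iff.mpr fun x => (key x).mono fun w hw => ?_)
  simp [hw]

instance : NeBot puncturedNhds := neBot_of_le (le_puncturedNhds 1)

/-- The field of meromorphic functions on the unit circle. -/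
abbrev QT : Type := subring

noncomputable instance : Field QT :=
  { (inferInstance : CommRing QT) with
    inv := fun q => ⟨(q : Germ puncturedNhds ℂ)⁻¹, inv_mem q.2⟩
    exists_pair_ne := ⟨0, 1, fun h =>
      zero_ne_one (α := Germ puncturedNhds ℂ) (congrArg Subtype.val h)⟩
    mul_inv_cancel := fun q hq => Subtype.ext (mul_inv_cancel q.2 fun h => hq (Subtype.ext h))
    inv_zero := Subtype.ext (Germ.coe_eq.mpr (Eventually.of_forall fun _ => inv_zero))
    nnqsmul := _
    nnqsmul_def := fun _ _ => rfl
    qsmul := _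
    qsmul_def := fun _ _ => rfl }

/-- `q` has no pole at the point `z` of the unit circle, and its value there is `c`: a function
representing `q` has the limit `c` at `z` (its value at `z` itself is immaterial). -/
def HasValueAt (q : QT) (z : Circle) (c : ℂ) : Prop :=
  ∃ f : ℂ → ℂ, (f : Germ puncturedNhds ℂ) = (q : Germ puncturedNhds ℂ) ∧
    Tendsto f (𝓝[≠] (z : ℂ)) (𝓝 c)

/-- The value does not depend on the representative. -/
theorem hasValueAt_coe_iff {q : QT} {z : Circle} {c : ℂ} {f : ℂ → ℂ}
    (hf : (f : Germ puncturedNhds ℂ) = (q : Germ puncturedNhds ℂ)) :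
    HasValueAt q z c ↔ Tendsto f (𝓝[≠] (z : ℂ)) (𝓝 c) := by
  constructor
  · rintro ⟨g, hg, hc⟩
    exact hc.congr' (eventually_iff.mp (Germ.coe_eq.mp (hg.trans hf.symm)) z)
  · exact fun h => ⟨f, hf, h⟩

theorem HasValueAt.unique {q : QT} {z : Circle} {c c' : ℂ} (h : HasValueAt q z c)
    (h' : HasValueAt q z c') : c = c' := by
  obtain ⟨f, hf, hc⟩ := h
  exact tendsto_nhds_unique hc ((hasValueAt_coe_iff hf).mp h')

/-- `g(·; z) = p`: no coefficient of `g` has a pole at `z`, and the complex polynomial obtained from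
`g` by taking the values of the coefficients at `z` is `p`. -/
def SpecializesTo (g : Polynomial QT) (z : Circle) (p : Polynomial ℂ) : Prop :=
  ∀ k : ℕ, HasValueAt (g.coeff k) z (p.coeff k)

/-- `lam` is analytic on a neighbourhood of the unit circle and, for every `z` on the circle,
`g(X; z)` is the product of the `X - lam ζ` over the complex numbers `ζ` with `ζ ^ d = z`. -/
def IsEigenfunction (g : Polynomial QT) (d : ℕ) (lam : ℂ → ℂ) : Prop :=
  AnalyticOnNhd ℂ lam (Metric.sphere 0 1) ∧
    ∀ z : Circle, SpecializesTo g z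
      (∏ ζ ∈ Polynomial.nthRootsFinset d (z : ℂ), (Polynomial.X - Polynomial.C (lam ζ)))

end MeroCircle

/-! Away from the poles the coefficients of `g` are elementary symmetric functions of numbers of
modulus one, hence bounded by binomial coefficients on the circle; so there are no poles, and `g`
comes from a polynomial with analytic coefficients (`exists_map_toQT_eq`). Substituting `z = exp (t
* I)` gives a `2π`-periodic family `P t` of monic polynomials, analytic along the real axis.

The analytic core is a Rellich theorem: the roots of `P t` can be chosen analytic near each real
point (`MonicFamily.linearSplit`). If `P` at that point is not a power of a linear factor, Hensel's
lemma splits it and the degree drops. Otherwise all nearby roots are close to one `c` on the circle,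
and `(x - y) ^ 2 = -x * y * ‖x - y‖ ^ 2` puts the squares of their differences in a strict convex
cone (`RootCone`). After recentring the roots to have sum zero, the sum `f` of their squares
dominates each of them, because nothing cancels in a cone. Real parameters of both signs force `f`
to vanish to an even order `2 * m` (or identically), so every root is `O(|t| ^ m)`. Dividing the
roots by `t ^ m` leaves an analytic family whose value at `0` is not a power of a linear factor;
Hensel applies and the cone condition survives.

Analytic roots are unique up to a permutation, so they glue to functions `nu i` along the whole real
axis, and translation by `2π` acts on them by a permutation `σ`. The product over an orbit of `σ` is
a factor of `g`; irreducibility makes `σ` a single `d`-cycle (`sameCycle_of_irreducible`). Hence `nu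
i₀ (d * s)` is `2π`-periodic and descends to the required `lam`. For two solutions, matching their
germs along the real axis at `0` and applying the identity theorem on the circle gives the rotation.
-/

open scoped Polynomial ContDiff

namespace MeroCircle

open Polynomial

/-! ### Hensel factorization for polynomials with analytic coefficients -/

/-- The polynomial of degree less than `n` with given coefficients. -/
noncomputable def lowPoly (n : ℕ) (v : Fin n → ℂ) : ℂ[X] :=
  ∑ i : Fin n, monomial (i : ℕ) (v i)

theorem coeff_lowPoly (n : ℕ) (v : Fin n → ℂ) (k : ℕ) :
    (lowPoly n v).coeff k = if h : k < n then v ⟨k, h⟩ else 0 := by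
  simp only [lowPoly, finsetSum_coeff, coeff_monomial]
  split_ifs with h
  · rw [Finset.sum_eq_single ⟨k, h⟩]
    · simp
    · intro i _ hi
      rw [if_neg]
      rintro rfl
      exact hi rfl
    · simp
  · refine Finset.sum_eq_zero fun i _ => if_neg fun hi => h ?_
    omega

theorem degree_lowPoly_lt (n : ℕ) (v : Fin n → ℂ) : (lowPoly n v).degree < n := by
  rw [degree_lt_iff_coeff_zero]
  intro m hm
  rw [coeff_lowPoly, dif_neg (by omega)]

theorem lowPoly_add (n : ℕ) (v w : Fin n → ℂ) : lowPoly n (v + w) = lowPoly n v + lowPoly n w := by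
  simp [lowPoly, Finset.sum_add_distrib]

theorem lowPoly_smul (n : ℕ) (s : ℂ) (v : Fin n → ℂ) : lowPoly n (s • v) = C s * lowPoly n v := by
  simp [lowPoly, Finset.mul_sum, C_mul_monomial]

theorem lowPoly_eq_zero {n : ℕ} {v : Fin n → ℂ} (h : lowPoly n v = 0) : v = 0 := by
  ext i
  have := coeff_lowPoly n v i
  simpa [h] using this.symm

/-- The monic polynomial of degree `n` with given lower coefficients. -/
noncomputable def monicPoly (n : ℕ) (v : Fin n → ℂ) : ℂ[X] := X ^ n + lowPoly n v

theorem monicPoly_monic (n : ℕ) (v : Fin n → ℂ) : (monicPoly n v).Monic :=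
  monic_X_pow_add (degree_lowPoly_lt n v)

theorem natDegree_monicPoly (n : ℕ) (v : Fin n → ℂ) : (monicPoly n v).natDegree = n := by
  refine natDegree_eq_of_degree_eq_some ?_
  rw [monicPoly, degree_add_eq_left_of_degree_lt] <;> simp [degree_lowPoly_lt]

theorem coeff_monicPoly (n : ℕ) (v : Fin n → ℂ) (k : ℕ) :
    (monicPoly n v).coeff k = (if k = n then 1 else 0) + if h : k < n then v ⟨k, h⟩ else 0 := by
  rw [monicPoly, coeff_add, coeff_X_pow, coeff_lowPoly]

theorem monicPoly_coeff {p : ℂ[X]} {n : ℕ} (hp : p.Monic) (hn : p.natDegree = n) :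
    monicPoly n (fun i => p.coeff i) = p := by
  ext k
  rw [coeff_monicPoly]
  rcases lt_trichotomy k n with h | h | h
  · simp [h, h.ne]
  · subst h; subst hn; simp [hp.leadingCoeff]
  · rw [if_neg h.ne', dif_neg (by omega), coeff_eq_zero_of_natDegree_lt (by omega), add_zero]

theorem monicPoly_line (n : ℕ) (u v : Fin n → ℂ) (s : ℂ) :
    monicPoly n (u + s • v) = monicPoly n u + C s * lowPoly n v := by
  rw [monicPoly, lowPoly_add, lowPoly_smul, monicPoly, add_assoc]

/-- The lower coefficients of the product of two monic polynomials. -/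
noncomputable def mulCoeffs (m n : ℕ) (x : (Fin m → ℂ) × (Fin n → ℂ)) : Fin (m + n) → ℂ :=
  fun k => (monicPoly m x.1 * monicPoly n x.2).coeff k

theorem monicPoly_mulCoeffs (m n : ℕ) (x : (Fin m → ℂ) × (Fin n → ℂ)) :
    monicPoly (m + n) (mulCoeffs m n x) = monicPoly m x.1 * monicPoly n x.2 :=
  monicPoly_coeff ((monicPoly_monic _ _).mul (monicPoly_monic _ _)) (by
    rw [(monicPoly_monic _ _).natDegree_mul (monicPoly_monic _ _), natDegree_monicPoly,
      natDegree_monicPoly])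

theorem contDiff_coeff_monicPoly (n k : ℕ) :
    ContDiff ℂ ω fun v : Fin n → ℂ => (monicPoly n v).coeff k := by
  simp only [coeff_monicPoly]
  by_cases h : k < n
  · simp only [h, dif_pos]
    fun_prop
  · simp only [h, dif_neg, not_false_eq_true]
    fun_prop

theorem contDiff_mulCoeffs (m n : ℕ) : ContDiff ℂ ω (mulCoeffs m n) := by
  refine contDiff_pi.2 fun k => ?_
  simp only [mulCoeffs, coeff_mul]
  exact ContDiff.sum fun i _ => ((contDiff_coeff_monicPoly m i.1).comp contDiff_fst).mul
    ((contDiff_coeff_monicPoly n i.2).comp contDiff_snd)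

/-- Along the line `x + s • δ` the product is quadratic in `s`, and the directional derivative is
its linear coefficient. -/
theorem fderiv_mulCoeffs_apply (m n : ℕ) (x δ : (Fin m → ℂ) × (Fin n → ℂ)) (k : Fin (m + n)) :
    fderiv ℂ (mulCoeffs m n) x δ k =
      (lowPoly m δ.1 * monicPoly n x.2 + monicPoly m x.1 * lowPoly n δ.2).coeff k := by
  have h1 : HasFDerivAt (mulCoeffs m n) (fderiv ℂ (mulCoeffs m n) x) x :=
    ((contDiff_mulCoeffs m n).differentiable (by simp) x).hasFDerivAt
  have h2 := hasDerivAt_pi.1 (h1.hasLineDerivAt δ) k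
  have h3 : (fun s : ℂ => mulCoeffs m n (x + s • δ) k) = fun s =>
      (monicPoly m x.1 * monicPoly n x.2).coeff k +
      s * (lowPoly m δ.1 * monicPoly n x.2 + monicPoly m x.1 * lowPoly n δ.2).coeff k +
      s ^ 2 * (lowPoly m δ.1 * lowPoly n δ.2).coeff k := by
    funext s
    simp only [mulCoeffs, Prod.fst_add, Prod.snd_add, Prod.smul_fst, Prod.smul_snd, monicPoly_line]
    rw [← coeff_C_mul, ← coeff_C_mul, ← coeff_add, ← coeff_add]
    congr 1
    rw [C_pow]
    ring
  rw [h3] at h2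
  refine h2.unique ?_
  have h4 := (((hasDerivAt_id (0 : ℂ)).mul_const
    ((lowPoly m δ.1 * monicPoly n x.2 + monicPoly m x.1 * lowPoly n δ.2).coeff k)).const_add
    ((monicPoly m x.1 * monicPoly n x.2).coeff k)).add (((hasDerivAt_id (0 : ℂ)).pow 2).mul_const
      ((lowPoly m δ.1 * lowPoly n δ.2).coeff k))
  exact h4.congr_deriv (by simp)

/-- A kernel vector is a relation `δ₁ * r + q * δ₂ = 0` with `deg δ₁ < deg q`. Coprimality makes `q`
divide `δ₁`, so `δ₁ = 0` and then `δ₂ = 0`. -/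
theorem fderiv_mulCoeffs_injective (m n : ℕ) (x : (Fin m → ℂ) × (Fin n → ℂ))
    (h : IsCoprime (monicPoly m x.1) (monicPoly n x.2)) :
    Function.Injective (fderiv ℂ (mulCoeffs m n) x) := by
  rw [injective_iff_map_eq_zero]
  intro δ hδ
  have hz : lowPoly m δ.1 * monicPoly n x.2 + monicPoly m x.1 * lowPoly n δ.2 = 0 := by
    ext k
    by_cases hk : k < m + n
    · have := congrFun hδ ⟨k, hk⟩
      rw [fderiv_mulCoeffs_apply] at this
      simpa using this
    · refine coeff_eq_zero_of_degree_lt (lt_of_lt_of_le ?_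
        (Nat.cast_le.2 (not_lt.1 hk) : ((m + n : ℕ) : WithBot ℕ) ≤ k))
      rw [Nat.cast_add]
      refine lt_of_le_of_lt (degree_add_le _ _) (max_lt ?_ ?_)
      · rw [degree_mul, degree_eq_natDegree (monicPoly_monic n x.2).ne_zero, natDegree_monicPoly]
        exact WithBot.add_lt_add_right (WithBot.natCast_ne_bot n) (degree_lowPoly_lt _ _)
      · rw [degree_mul, degree_eq_natDegree (monicPoly_monic m x.1).ne_zero, natDegree_monicPoly]
        exact WithBot.add_lt_add_left (WithBot.natCast_ne_bot m) (degree_lowPoly_lt _ _)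
  have h1 : lowPoly m δ.1 = 0 := by
    have hd : monicPoly m x.1 ∣ lowPoly m δ.1 := by
      refine h.dvd_of_dvd_mul_right (z := monicPoly n x.2) ⟨-lowPoly n δ.2, ?_⟩
      linear_combination hz
    refine eq_zero_of_dvd_of_degree_lt hd ?_
    rw [degree_eq_natDegree (monicPoly_monic m x.1).ne_zero, natDegree_monicPoly]
    exact degree_lowPoly_lt _ _
  have h2 : lowPoly n δ.2 = 0 := by
    rw [h1, zero_mul, zero_add] at hz
    exact (mul_eq_zero.1 hz).resolve_left (monicPoly_monic m x.1).ne_zero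
  exact Prod.ext (lowPoly_eq_zero h1) (lowPoly_eq_zero h2)

/-- A family of monic polynomials of degree `d` whose coefficients are analytic at `0`. -/
structure MonicFamily (d : ℕ) (p : ℂ → ℂ[X]) : Prop where
  monic : ∀ t, (p t).Monic
  natDegree : ∀ t, (p t).natDegree = d
  analyticAt : ∀ k, AnalyticAt ℂ (fun t => (p t).coeff k) 0

theorem monicFamily_monicPoly {n : ℕ} {a : ℂ → Fin n → ℂ} (ha : AnalyticAt ℂ a 0) :
    MonicFamily n fun t => monicPoly n (a t) where
  monic t := monicPoly_monic n (a t)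
  natDegree t := natDegree_monicPoly n (a t)
  analyticAt k := ((contDiff_coeff_monicPoly n k).contDiffAt.analyticAt).comp ha

/-- Hensel's lemma for polynomials with analytic coefficients: a factorization into coprime monic
polynomials at one point extends to a neighbourhood. -/
theorem MonicFamily.exists_factorization {d m n : ℕ} {p : ℂ → ℂ[X]} (hp : MonicFamily d p)
    {q r : ℂ[X]} (hq : q.Monic) (hr : r.Monic) (hqm : q.natDegree = m) (hrn : r.natDegree = n)
    (hqr : IsCoprime q r) (h0 : p 0 = q * r) :
    ∃ p₁ p₂ : ℂ → ℂ[X], MonicFamily m p₁ ∧ MonicFamily n p₂ ∧ p₁ 0 = q ∧ p₂ 0 = r ∧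
      ∀ᶠ t in 𝓝 (0 : ℂ), p t = p₁ t * p₂ t := by
  have hd : d = m + n := by
    rw [← hp.natDegree 0, h0, hq.natDegree_mul hr, hqm, hrn]
  subst hd
  set x : (Fin m → ℂ) × (Fin n → ℂ) := (fun i => q.coeff i, fun i => r.coeff i) with hx
  have hq' : monicPoly m x.1 = q := monicPoly_coeff hq hqm
  have hr' : monicPoly n x.2 = r := monicPoly_coeff hr hrn
  have hinj := fderiv_mulCoeffs_injective m n x (by rwa [hq', hr'])
  -- Both sides have dimension `m + n`, so injectivity suffices for the inverse function theorem;
  -- its analytic local inverse lifts the coefficients of `p t` to those of two factors.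
  let e : ((Fin m → ℂ) × (Fin n → ℂ)) ≃L[ℂ] (Fin (m + n) → ℂ) :=
    (LinearEquiv.ofInjectiveOfFinrankEq (fderiv ℂ (mulCoeffs m n) x).toLinearMap hinj
      (by simp)).toContinuousLinearEquiv
  have hc : ContDiffAt ℂ ω (mulCoeffs m n) x := (contDiff_mulCoeffs m n).contDiffAt
  have hF : HasFDerivAt (mulCoeffs m n) (e : _ →L[ℂ] _) x := by
    have h1 : HasFDerivAt (mulCoeffs m n) (fderiv ℂ (mulCoeffs m n) x) x :=
      ((contDiff_mulCoeffs m n).differentiable (by simp) x).hasFDerivAt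
    convert h1 using 1
    exact ContinuousLinearMap.ext fun v => rfl
  have hω : (ω : WithTop ℕ∞) ≠ 0 := by simp
  let s := hc.localInverse hF hω
  have hs : ContDiffAt ℂ ω s (mulCoeffs m n x) := hc.to_localInverse hF hω
  have hsx : s (mulCoeffs m n x) = x := hc.localInverse_apply_image hF hω
  have hright : ∀ᶠ y in 𝓝 (mulCoeffs m n x), mulCoeffs m n (s y) = y :=
    (hc.hasStrictFDerivAt' hF hω).eventually_right_inverse
  let a : ℂ → Fin (m + n) → ℂ := fun t i => (p t).coeff i
  have ha : AnalyticAt ℂ a 0 := analyticAt_pi_iff.2 fun i => hp.analyticAt i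
  have ha0 : a 0 = mulCoeffs m n x := by
    funext k
    simp only [a, mulCoeffs, h0, hq', hr']
  have hsa : AnalyticAt ℂ (fun t => s (a t)) 0 := by
    refine AnalyticAt.fun_comp ?_ ha
    rw [ha0]
    exact hs.analyticAt
  refine ⟨fun t => monicPoly m (s (a t)).1, fun t => monicPoly n (s (a t)).2,
    monicFamily_monicPoly (analyticAt_fst.fun_comp hsa),
    monicFamily_monicPoly (analyticAt_snd.fun_comp hsa), ?_, ?_, ?_⟩
  · simp only [ha0, hsx, hq']
  · simp only [ha0, hsx, hr']
  · have hac : Tendsto a (𝓝 0) (𝓝 (mulCoeffs m n x)) := ha0 ▸ ha.continuousAt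
    filter_upwards [hac.eventually hright] with t ht
    rw [← monicPoly_mulCoeffs, ht]
    exact (monicPoly_coeff (hp.monic t) (hp.natDegree t)).symm

/-! ### Splitting into linear factors with analytic roots -/

/-- A family of polynomials which is, near `0`, a product of linear factors with analytic roots. -/
def LinearSplit (p : ℂ → ℂ[X]) : Prop :=
  ∃ L : Multiset (ℂ → ℂ), (∀ f ∈ L, AnalyticAt ℂ f 0) ∧
    ∀ᶠ t in 𝓝 (0 : ℂ), p t = (L.map fun f => X - C (f t)).prod

theorem LinearSplit.of_mul {p p₁ p₂ : ℂ → ℂ[X]} (h₁ : LinearSplit p₁) (h₂ : LinearSplit p₂)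
    (h : ∀ᶠ t in 𝓝 (0 : ℂ), p t = p₁ t * p₂ t) : LinearSplit p := by
  obtain ⟨L₁, hL₁, e₁⟩ := h₁
  obtain ⟨L₂, hL₂, e₂⟩ := h₂
  refine ⟨L₁ + L₂, fun f hf => (Multiset.mem_add.1 hf).elim (hL₁ f) (hL₂ f), ?_⟩
  filter_upwards [h, e₁, e₂] with t h e₁ e₂
  rw [h, e₁, e₂, Multiset.map_add, Multiset.prod_add]

/-- Undoes the two normalizations of the roots: division by `s = t ^ m` and recentring by `a`. -/
theorem LinearSplit.transform {p q : ℂ → ℂ[X]} (hq : LinearSplit q) {s a : ℂ → ℂ}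
    (hs : AnalyticAt ℂ s 0) (ha : AnalyticAt ℂ a 0)
    (h : ∀ᶠ t in 𝓝 (0 : ℂ), p t = ((q t).scaleRoots (s t)).comp (X - C (a t))) :
    LinearSplit p := by
  obtain ⟨L, hL, e⟩ := hq
  refine ⟨L.map fun f t => s t * f t + a t, ?_, ?_⟩
  · intro f hf
    obtain ⟨g, hg, rfl⟩ := Multiset.mem_map.1 hf
    exact (hs.mul (hL g hg)).add ha
  filter_upwards [h, e] with t h e
  rw [h, e, Multiset.map_map]
  clear! p q
  clear hL
  induction L using Multiset.induction_on with
  | empty => simp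
  | cons f L ih =>
    simp only [Multiset.map_cons, Multiset.prod_cons, mul_scaleRoots_of_noZeroDivisors, mul_comp,
      X_sub_C_scaleRoots, Function.comp_apply] at ih ⊢
    rw [ih]
    congr 1
    simp only [sub_comp, X_comp, C_comp, C_add, C_mul, mul_comp]
    ring

/-- At `0`, split off the full power of `X - C c` for one root `c`. The cofactor is coprime to it
and nonconstant, so Hensel's lemma lowers both degrees. -/
theorem MonicFamily.exists_factorization_of_ne_pow {d : ℕ} {p : ℂ → ℂ[X]} (hp : MonicFamily d p)
    (h : ∀ c : ℂ, p 0 ≠ (X - C c) ^ d) :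
    ∃ m n : ℕ, m < d ∧ n < d ∧ ∃ p₁ p₂ : ℂ → ℂ[X], MonicFamily m p₁ ∧ MonicFamily n p₂ ∧
      ∀ᶠ t in 𝓝 (0 : ℂ), p t = p₁ t * p₂ t := by
  have hd : d ≠ 0 := by
    rintro rfl
    exact h 0 (by rw [pow_zero]; exact (hp.monic 0).natDegree_eq_zero.1 (hp.natDegree 0))
  obtain ⟨c, hc⟩ := IsAlgClosed.exists_root (p 0) (by
    rw [degree_eq_natDegree (hp.monic 0).ne_zero, hp.natDegree]
    exact_mod_cast hd)
  obtain ⟨r, hr, hcr⟩ := exists_eq_pow_rootMultiplicity_mul_and_not_dvd (p 0) (hp.monic 0).ne_zero c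
  set m := (p 0).rootMultiplicity c with hm
  have hmpos : 0 < m := (rootMultiplicity_pos (hp.monic 0).ne_zero).2 hc
  have hmon : ((X - C c) ^ m).Monic := (monic_X_sub_C c).pow m
  have hrmon : r.Monic := hmon.of_mul_monic_left (hr ▸ hp.monic 0)
  have hmd : ((X - C c) ^ m).natDegree = m := by simp
  have hdeg : m + r.natDegree = d := by
    rw [← hp.natDegree 0, hr, hmon.natDegree_mul hrmon, hmd]
  have hrpos : r.natDegree ≠ 0 := by
    intro h0
    have hr1 : r = 1 := hrmon.natDegree_eq_zero.1 h0
    rw [h0, add_zero] at hdeg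
    exact h c (by rw [hr, hr1, mul_one, hdeg])
  have hcop : IsCoprime ((X - C c) ^ m) r :=
    (((irreducible_X_sub_C c).coprime_iff_not_dvd).2 hcr).pow_left
  obtain ⟨p₁, p₂, h₁, h₂, -, -, he⟩ := hp.exists_factorization hmon hrmon hmd rfl hcop hr
  exact ⟨m, r.natDegree, by omega, by omega, p₁, p₂, h₁, h₂, he⟩

/-! ### Power sums and bounds for roots -/

theorem exists_eq_prod_X_sub_C {p : ℂ[X]} {d : ℕ} (hp : p.Monic) (hd : p.natDegree = d) :
    ∃ μ : Fin d → ℂ, p = ∏ i, (X - C (μ i)) := by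
  have hs : p.Splits := IsAlgClosed.splits p
  have hcard : p.roots.toList.length = d := by
    rw [Multiset.length_toList, ← hd, hs.natDegree_eq_card_roots]
  subst hcard
  refine ⟨p.roots.toList.get, (hs.eq_prod_roots_of_monic hp).trans ?_⟩
  conv_lhs => rw [← Multiset.coe_toList p.roots, Multiset.map_coe, Multiset.prod_coe]
  rw [← List.prod_ofFn]
  congr 1
  conv_lhs => rw [← List.ofFn_get p.roots.toList, List.map_ofFn]
  rfl

theorem sum_sum_sub_sq {R : Type*} [CommRing R] {d : ℕ} (μ : Fin d → R) :
    ∑ i, ∑ j, (μ i - μ j) ^ 2 = 2 * d * ∑ i, μ i ^ 2 - 2 * (∑ i, μ i) ^ 2 := by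
  simp only [sub_sq, Finset.sum_add_distrib, Finset.sum_sub_distrib, Finset.sum_const,
    Finset.card_univ, Fintype.card_fin, nsmul_eq_mul, ← Finset.mul_sum, ← Finset.sum_mul]
  ring

/-- Sum the hypothesis over all pairs. As the mean is zero, both double sums are `2 * d` times the
corresponding single sums. -/
theorem sum_norm_sq_le {d : ℕ} {u : ℂ} {μ : Fin d → ℂ} (h0 : ∑ i, μ i = 0)
    (h : ∀ i j, ‖μ i - μ j‖ ^ 2 ≤ (u * (μ i - μ j) ^ 2).re) :
    ∑ i, ‖μ i‖ ^ 2 ≤ (u * ∑ i, μ i ^ 2).re := by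
  rcases Nat.eq_zero_or_pos d with rfl | hd
  · simp
  have h1 : ∑ i, ∑ j, ‖μ i - μ j‖ ^ 2 ≤ ∑ i, ∑ j, (u * (μ i - μ j) ^ 2).re :=
    Finset.sum_le_sum fun i _ => Finset.sum_le_sum fun j _ => h i j
  have h2 : ∑ i, ∑ j, (u * (μ i - μ j) ^ 2).re = 2 * d * (u * ∑ i, μ i ^ 2).re := by
    simp only [← Complex.re_sum, ← Finset.mul_sum]
    rw [sum_sum_sub_sq, h0]
    have : u * (2 * d * ∑ i, μ i ^ 2 - 2 * 0 ^ 2) = ((2 * d : ℝ) : ℂ) * (u * ∑ i, μ i ^ 2) := by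
      push_cast; ring
    rw [this, Complex.re_ofReal_mul]
  have h3 : ∑ i, ∑ j, ‖μ i - μ j‖ ^ 2 = 2 * d * ∑ i, ‖μ i‖ ^ 2 := by
    have hn : ∀ z : ℂ, ‖z‖ ^ 2 = z.re ^ 2 + z.im ^ 2 := fun z => by
      rw [Complex.sq_norm, Complex.normSq_apply]; ring
    have hre : ∑ i, (μ i).re = 0 := by rw [← Complex.re_sum, h0, Complex.zero_re]
    have him : ∑ i, (μ i).im = 0 := by rw [← Complex.im_sum, h0, Complex.zero_im]
    simp only [hn, Complex.sub_re, Complex.sub_im, Finset.sum_add_distrib]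
    rw [sum_sum_sub_sq, sum_sum_sub_sq, hre, him]
    ring
  rw [h2, h3] at h1
  have hd' : (0 : ℝ) < 2 * d := by positivity
  exact le_of_mul_le_mul_left h1 hd'

theorem two_mul_esymm_two {R : Type*} [CommRing R] (s : Multiset R) :
    2 * s.esymm 2 = s.sum ^ 2 - (s.map (· ^ 2)).sum := by
  induction s using Multiset.induction_on with
  | empty => simp [Multiset.esymm, Multiset.powersetCard_zero_right]
  | cons a s ih =>
    have : (a ::ₘ s).esymm 2 = s.esymm 2 + a * s.sum := by
      have h1 : (s.map fun x => a * x).sum = a * s.sum := by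
        rw [Multiset.sum_map_mul_left, Multiset.map_id']
      simpa [Multiset.esymm, Multiset.powersetCard_cons, Multiset.powersetCard_one,
        Function.comp_def] using h1
    rw [this, mul_add, ih]
    simp only [Multiset.sum_cons, Multiset.map_cons]
    ring

/-- Newton's identity for the second power sum. It shows that the sum of squares of the roots
depends analytically on the parameter, though the roots are not yet known to. -/
theorem coeff_prod_X_sub_C_of_sum_eq_zero {n : ℕ} {μ : Fin (n + 2) → ℂ} (h0 : ∑ i, μ i = 0) :
    -2 * (∏ i, (X - C (μ i))).coeff n = ∑ i, μ i ^ 2 := by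
  have h := Multiset.prod_X_sub_C_coeff (Finset.univ.val.map μ) (k := n)
    (by simp only [Multiset.card_map, Finset.card_val, Finset.card_univ, Fintype.card_fin]; omega)
  have h2 := two_mul_esymm_two (Finset.univ.val.map μ)
  rw [Multiset.map_map] at h h2
  have hc : (Finset.univ.val.map μ).card - n = 2 := by
    simp only [Multiset.card_map, Finset.card_val, Finset.card_univ, Fintype.card_fin]; omega
  rw [hc] at h
  have h3 : (Finset.univ.val.map μ).sum = ∑ i, μ i := rfl
  have h4 : (Finset.univ.val.map ((fun x => x ^ 2) ∘ μ)).sum = ∑ i, μ i ^ 2 := rfl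
  have h5 : (Finset.univ.val.map ((fun a => X - C a) ∘ μ)).prod = ∏ i, (X - C (μ i)) := rfl
  rw [h3, h4, h0] at h2
  rw [h5] at h
  rw [h]
  linear_combination -h2

theorem norm_coeff_prod_X_sub_C_le {d : ℕ} {μ : Fin d → ℂ} {B : ℝ} (hB : ∀ i, ‖μ i‖ ≤ B) (k : ℕ) :
    ‖(∏ i, (X - C (μ i))).coeff k‖ ≤ B ^ (d - k) * d.choose k := by
  have hm : (∏ i, (X - C (μ i))).Monic := monic_prod_of_monic _ _ fun i _ => monic_X_sub_C _
  have := coeff_le_of_roots_le (p := ∏ i, (X - C (μ i))) (f := RingHom.id ℂ) (B := B) k hm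
    (IsAlgClosed.splits _) (by
      intro z hz
      rw [Polynomial.map_id, mem_roots hm.ne_zero, IsRoot, eval_prod, Finset.prod_eq_zero_iff] at hz
      obtain ⟨i, -, hi⟩ := hz
      rw [eval_sub, eval_X, eval_C, sub_eq_zero] at hi
      exact hi ▸ hB i)
  simpa [natDegree_finsetProd_X_sub_C_eq_card] using this

/-! ### Orders of vanishing detected along the real axis -/

theorem tendsto_ofReal_nhdsNE_zero :
    Tendsto (fun t : ℝ => (t : ℂ)) (𝓝[≠] 0) (𝓝[≠] 0) := by
  refine tendsto_nhdsWithin_of_tendsto_nhds_of_eventually_within _ ?_ ?_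
  · have h : Tendsto (fun t : ℝ => (t : ℂ)) (𝓝 0) (𝓝 0) := by
      have := Complex.continuous_ofReal.tendsto 0
      rwa [Complex.ofReal_zero] at this
    exact h.mono_left nhdsWithin_le_nhds
  · filter_upwards [self_mem_nhdsWithin] with t ht
    simpa using ht

/-- A function analytic at `0` which is `O(t ^ k)` along the reals is divisible by `t ^ k`. -/
theorem exists_eq_pow_mul_of_norm_le {h : ℂ → ℂ} (hh : AnalyticAt ℂ h 0) {k : ℕ} {K : ℝ}
    (hb : ∀ᶠ t : ℝ in 𝓝[≠] 0, ‖h t‖ ≤ K * |t| ^ k) :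
    ∃ b : ℂ → ℂ, AnalyticAt ℂ b 0 ∧ ∀ᶠ t in 𝓝 (0 : ℂ), h t = t ^ k * b t := by
  suffices hk : (k : ℕ∞) ≤ analyticOrderAt h 0 by
    obtain ⟨b, hb, he⟩ := (natCast_le_analyticOrderAt hh).1 hk
    exact ⟨b, hb, by simpa using he⟩
  by_contra! hlt
  obtain ⟨n, hn⟩ := ENat.ne_top_iff_exists.1 hlt.ne_top
  rw [← hn] at hlt
  have hnk : n < k := by exact_mod_cast hlt
  obtain ⟨g, hg, hg0, he⟩ := (hh.analyticOrderAt_eq_natCast).1 hn.symm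
  simp only [sub_zero, smul_eq_mul] at he
  -- If the order `n` were less than `k`, the leading coefficient `g 0` would be a limit of
  -- quantities bounded by `K * |t| ^ (k - n)`, which tend to `0`.
  apply hg0
  have h1 : Tendsto (fun t : ℝ => ‖g t‖) (𝓝[≠] 0) (𝓝 ‖g 0‖) :=
    ((hg.continuousAt.tendsto.mono_left nhdsWithin_le_nhds).comp tendsto_ofReal_nhdsNE_zero).norm
  have h2 : Tendsto (fun t : ℝ => K * |t| ^ (k - n)) (𝓝[≠] 0) (𝓝 0) := by
    have : ContinuousAt (fun t : ℝ => K * |t| ^ (k - n)) 0 := by fun_prop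
    have h3 := this.tendsto.mono_left (nhdsWithin_le_nhds (s := {0}ᶜ))
    simpa [(Nat.sub_pos_of_lt hnk).ne'] using h3
  have h3 : ∀ᶠ t : ℝ in 𝓝[≠] 0, ‖g t‖ ≤ K * |t| ^ (k - n) := by
    filter_upwards [hb, tendsto_ofReal_nhdsNE_zero.eventually (he.filter_mono nhdsWithin_le_nhds),
      self_mem_nhdsWithin] with t h1 h2 ht
    rw [h2, norm_mul, norm_pow, Complex.norm_real, Real.norm_eq_abs,
      ← Nat.sub_add_cancel hnk.le, pow_add, ← mul_assoc, mul_comm (_ * _)] at h1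
    have ht' : 0 < |t| ^ n := pow_pos (abs_pos.2 ht) n
    exact le_of_mul_le_mul_left h1 ht'
  have h4 : ‖g 0‖ ≤ 0 := le_of_tendsto_of_tendsto h1 h2 h3
  exact norm_le_zero_iff.1 h4

/-- If an analytic function takes values in a strict convex cone along the reals, then it vanishes
to even order. -/
theorem exists_eq_pow_two_mul_of_norm_le_re {f : ℂ → ℂ} (hf : AnalyticAt ℂ f 0) {u : ℂ}
    (hu : ∀ᶠ t : ℝ in 𝓝[≠] 0, ‖f t‖ ≤ (u * f t).re) :
    (∀ᶠ t in 𝓝 (0 : ℂ), f t = 0) ∨ ∃ (m : ℕ) (g : ℂ → ℂ), AnalyticAt ℂ g 0 ∧ g 0 ≠ 0 ∧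
      ∀ᶠ t in 𝓝 (0 : ℂ), f t = t ^ (2 * m) * g t := by
  by_cases hz : ∀ᶠ t in 𝓝 (0 : ℂ), f t = 0
  · exact Or.inl hz
  right
  obtain ⟨n, g, hg, hg0, he⟩ := hf.exists_eventuallyEq_pow_smul_nonzero_iff.2 hz
  simp only [sub_zero, smul_eq_mul] at he
  rcases Nat.even_or_odd n with hn | hn
  · obtain ⟨m, rfl⟩ := hn
    exact ⟨m, g, hg, hg0, by simpa [two_mul] using he⟩
  -- For odd `n` the factor `t ^ n` changes sign at `0`, so the one-sided limits put both `g 0` and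
  -- `-g 0` in the cone, forcing `g 0 = 0`.
  exfalso
  have hgt : Tendsto (fun t : ℝ => g t) (𝓝[≠] 0) (𝓝 (g 0)) :=
    (hg.continuousAt.tendsto.mono_left nhdsWithin_le_nhds).comp tendsto_ofReal_nhdsNE_zero
  have h1 : ∀ᶠ t : ℝ in 𝓝[≠] 0, |t| ^ n * ‖g t‖ ≤ t ^ n * (u * g t).re := by
    filter_upwards [hu, tendsto_ofReal_nhdsNE_zero.eventually
      (he.filter_mono nhdsWithin_le_nhds)] with t h1 h2
    rw [h2, norm_mul, norm_pow, Complex.norm_real, Real.norm_eq_abs] at h1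
    have : u * ((t : ℂ) ^ n * g t) = ((t ^ n : ℝ) : ℂ) * (u * g t) := by push_cast; ring
    rwa [this, Complex.re_ofReal_mul] at h1
  have hre : Tendsto (fun t : ℝ => (u * g t).re) (𝓝[≠] 0) (𝓝 (u * g 0).re) :=
    (Complex.continuous_re.tendsto _).comp (hgt.const_mul u)
  have hpos : ‖g 0‖ ≤ (u * g 0).re := by
    have hle : 𝓝[>] (0 : ℝ) ≤ 𝓝[≠] 0 := nhdsWithin_mono _ fun t ht => ne_of_gt ht
    refine le_of_tendsto_of_tendsto (hgt.norm.mono_left hle) (hre.mono_left hle) ?_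
    filter_upwards [h1.filter_mono hle, self_mem_nhdsWithin] with t h1 ht
    have ht : 0 < t := ht
    rw [abs_of_pos ht] at h1
    exact le_of_mul_le_mul_left h1 (pow_pos ht n)
  have hneg : ‖g 0‖ ≤ -(u * g 0).re := by
    have hle : 𝓝[<] (0 : ℝ) ≤ 𝓝[≠] 0 := nhdsWithin_mono _ fun t ht => ne_of_lt ht
    refine le_of_tendsto_of_tendsto (hgt.norm.mono_left hle) (hre.neg.mono_left hle) ?_
    filter_upwards [h1.filter_mono hle, self_mem_nhdsWithin] with t h1 ht
    have ht : t < 0 := ht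
    rw [← abs_neg, abs_of_pos (neg_pos.2 ht)] at h1
    have h2 : t ^ n = -(-t) ^ n := by rw [hn.neg_pow, neg_neg]
    rw [h2, neg_mul, ← mul_neg] at h1
    exact le_of_mul_le_mul_left h1 (pow_pos (neg_pos.2 ht) n)
  have : ‖g 0‖ ≤ 0 := by linarith
  exact hg0 (norm_le_zero_iff.1 this)

/-! ### Rellich's theorem under the cone condition -/

/-- For real `t ≠ 0` near `0`, all differences of roots of `p t` have their squares in a fixed
strict convex cone. -/
def RootCone (u : ℂ) (p : ℂ → ℂ[X]) : Prop :=
  ∀ᶠ t : ℝ in 𝓝[≠] 0, ∀ x y : ℂ, (p t).IsRoot x → (p t).IsRoot y →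
    ‖x - y‖ ^ 2 ≤ (u * (x - y) ^ 2).re

theorem RootCone.of_mul {u : ℂ} {p p₁ p₂ : ℂ → ℂ[X]} (hp : RootCone u p)
    (h : ∀ᶠ t in 𝓝 (0 : ℂ), p t = p₁ t * p₂ t) : RootCone u p₁ ∧ RootCone u p₂ := by
  have h' := tendsto_ofReal_nhdsNE_zero.eventually (h.filter_mono nhdsWithin_le_nhds)
  constructor
  · filter_upwards [hp, h'] with t h1 h2 x y hx hy
    exact h1 x y (h2 ▸ root_mul_right_of_isRoot _ hx) (h2 ▸ root_mul_right_of_isRoot _ hy)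
  · filter_upwards [hp, h'] with t h1 h2 x y hx hy
    exact h1 x y (h2 ▸ root_mul_left_of_isRoot _ hx) (h2 ▸ root_mul_left_of_isRoot _ hy)

/-- The translate of a monic family by an analytic function is a monic family. -/
theorem MonicFamily.comp_X_add_C {d : ℕ} {p : ℂ → ℂ[X]} (hp : MonicFamily d p) {a : ℂ → ℂ}
    (ha : AnalyticAt ℂ a 0) : MonicFamily d fun t => (p t).comp (X + C (a t)) where
  monic t := (hp.monic t).comp_X_add_C (a t)
  natDegree t := by rw [natDegree_comp, natDegree_X_add_C, mul_one, hp.natDegree]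
  analyticAt k := by
    have : (fun t => ((p t).comp (X + C (a t))).coeff k) = fun t =>
        ∑ i ∈ Finset.range (d + 1), (p t).coeff i * (a t ^ (i - k) * (i.choose k : ℂ)) := by
      funext t
      rw [comp, eval₂_eq_sum_range, hp.natDegree, finsetSum_coeff]
      simp only [coeff_C_mul, coeff_X_add_C_pow]
    rw [this]
    have h1 := hp.analyticAt
    fun_prop

theorem linearSplit_of_coeff_eq_zero {d : ℕ} {p : ℂ → ℂ[X]} (hp : MonicFamily d p)
    (h : ∀ᶠ t : ℝ in 𝓝[≠] 0, ∀ k < d, (p t).coeff k = 0) : LinearSplit p := by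
  have h1 : ∀ᶠ t in 𝓝 (0 : ℂ), ∀ k ∈ Finset.range d, (p t).coeff k = 0 := by
    rw [eventually_all_finset]
    intro k hk
    refine ((hp.analyticAt k).frequently_zero_iff_eventually_zero).1 ?_
    refine tendsto_ofReal_nhdsNE_zero.frequently (Eventually.frequently ?_)
    filter_upwards [h] with t ht using ht k (Finset.mem_range.1 hk)
  refine ⟨Multiset.replicate d 0, ?_, ?_⟩
  · intro f hf
    rw [Multiset.eq_of_mem_replicate hf]
    exact analyticAt_const
  filter_upwards [h1] with t ht
  have : (fun i : Fin d => (p t).coeff i) = 0 := by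
    funext i
    exact ht i (Finset.mem_range.2 i.2)
  rw [← monicPoly_coeff (hp.monic t) (hp.natDegree t), this]
  simp [monicPoly, lowPoly]

theorem prod_X_sub_C_comp_X_add_C {d : ℕ} (μ : Fin d → ℂ) (a : ℂ) :
    (∏ i, (X - C (μ i))).comp (X + C a) = ∏ i, (X - C (μ i - a)) := by
  rw [prod_comp]
  refine Finset.prod_congr rfl fun i _ => ?_
  simp only [sub_comp, X_comp, C_comp, C_sub]
  ring

/-- The shift is by the mean of the roots, since the subleading coefficient is minus their sum. -/
theorem coeff_comp_X_add_C_eq_zero {n : ℕ} {p : ℂ[X]} (hp : p.Monic) (hd : p.natDegree = n + 2) :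
    (p.comp (X + C (-(p.coeff (n + 1)) / (n + 2)))).coeff (n + 1) = 0 := by
  obtain ⟨μ, hμ⟩ := exists_eq_prod_X_sub_C hp hd
  have hc : ∀ ν : Fin (n + 2) → ℂ, (∏ i, (X - C (ν i))).coeff (n + 1) = -∑ i, ν i := fun ν => by
    simpa using prod_X_sub_C_coeff_card_pred Finset.univ ν (by simp)
  rw [hμ, prod_X_sub_C_comp_X_add_C, hc, hc]
  have : (n : ℂ) + 2 ≠ 0 := by exact_mod_cast (by omega : n + 2 ≠ 0)
  simp only [Finset.sum_sub_distrib, Finset.sum_const, Finset.card_univ, Fintype.card_fin,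
    nsmul_eq_mul]
  push_cast
  field_simp
  ring

theorem RootCone.comp_X_add_C {u : ℂ} {p : ℂ → ℂ[X]} (hp : RootCone u p) (a : ℂ → ℂ) :
    RootCone u fun t => (p t).comp (X + C (a t)) := by
  filter_upwards [hp] with t ht x y hx hy
  have := ht (x + a t) (y + a t) (by simpa [IsRoot, eval_comp] using hx)
    (by simpa [IsRoot, eval_comp] using hy)
  simpa using this

/-- For real `t ≠ 0` the scaling multiplies both sides of the cone inequality by the positive number
`(t ^ m) ^ 2`. This is why the condition is imposed at real parameters only. -/
theorem RootCone.of_scaleRoots {u : ℂ} {m : ℕ} {p q : ℂ → ℂ[X]} (hp : RootCone u p)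
    (h : ∀ᶠ t in 𝓝 (0 : ℂ), p t = (q t).scaleRoots (t ^ m)) : RootCone u q := by
  filter_upwards [hp, tendsto_ofReal_nhdsNE_zero.eventually (h.filter_mono nhdsWithin_le_nhds),
    self_mem_nhdsWithin] with t h1 h2 ht x y hx hy
  have hr : ∀ z, (q t).IsRoot z → (p t).IsRoot ((t : ℂ) ^ m * z) := fun z hz => by
    rw [h2, IsRoot, scaleRoots_eval_mul, hz.eq_zero, mul_zero]
  have h3 := h1 _ _ (hr x hx) (hr y hy)
  have h4 : u * ((t : ℂ) ^ m * x - (t : ℂ) ^ m * y) ^ 2 =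
      (((t ^ m) ^ 2 : ℝ) : ℂ) * (u * (x - y) ^ 2) := by push_cast; ring
  rw [h4, Complex.re_ofReal_mul, ← mul_sub, norm_mul, mul_pow, norm_pow, Complex.norm_real,
    ← norm_pow, Real.norm_eq_abs, sq_abs] at h3
  exact le_of_mul_le_mul_left h3 (sq_pos_of_ne_zero (pow_ne_zero m ht))

/-- The recentred family of a family with the cone property is split, or after dividing the roots
by a power of the variable it is no power of a linear polynomial at `0`. -/
theorem RootCone.linearSplit_or_exists_scaleRoots {n : ℕ} {u : ℂ} {q : ℂ → ℂ[X]}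
    (hq : MonicFamily (n + 2) q) (hu : RootCone u q) (h0 : ∀ t, (q t).coeff (n + 1) = 0) :
    LinearSplit q ∨ ∃ (m : ℕ) (r : ℂ → ℂ[X]), MonicFamily (n + 2) r ∧
      (∀ c : ℂ, r 0 ≠ (X - C c) ^ (n + 2)) ∧
      ∀ᶠ t in 𝓝 (0 : ℂ), q t = (r t).scaleRoots (t ^ m) := by
  have hsum : ∀ ν : Fin (n + 2) → ℂ, (∏ i, (X - C (ν i))).coeff (n + 1) = -∑ i, ν i := fun ν => by
    simpa using prod_X_sub_C_coeff_card_pred Finset.univ ν (by simp)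
  -- By `coeff_prod_X_sub_C_of_sum_eq_zero`, `f t` is the sum of the squares of the roots of `q t`.
  set f : ℂ → ℂ := fun t => -2 * (q t).coeff n with hf
  have hfa : AnalyticAt ℂ f 0 := analyticAt_const.mul (hq.analyticAt n)
  have key : ∀ᶠ t : ℝ in 𝓝[≠] 0, ∃ μ : Fin (n + 2) → ℂ, q t = ∏ i, (X - C (μ i)) ∧
      (∀ i, ‖μ i‖ ^ 2 ≤ ‖u‖ * ‖f t‖) ∧ ‖f t‖ ≤ (u * f t).re := by
    filter_upwards [hu] with t ht
    obtain ⟨μ, hμ⟩ := exists_eq_prod_X_sub_C (hq.monic t) (hq.natDegree t)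
    have hμ0 : ∑ i, μ i = 0 := by
      have := h0 t
      rw [hμ, hsum] at this
      exact neg_eq_zero.1 this
    have hroot : ∀ i, (q t).IsRoot (μ i) := fun i => by
      rw [hμ, IsRoot, eval_prod]
      exact Finset.prod_eq_zero (Finset.mem_univ i) (by simp)
    have hfμ : f t = ∑ i, μ i ^ 2 := by
      rw [hf, ← coeff_prod_X_sub_C_of_sum_eq_zero hμ0, ← hμ]
    have hle := sum_norm_sq_le hμ0 fun i j => ht _ _ (hroot i) (hroot j)
    rw [← hfμ] at hle
    refine ⟨μ, hμ, fun i => ?_, ?_⟩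
    · calc ‖μ i‖ ^ 2 ≤ ∑ i, ‖μ i‖ ^ 2 :=
          Finset.single_le_sum (f := fun i => ‖μ i‖ ^ 2) (fun j _ => sq_nonneg _) (Finset.mem_univ i)
        _ ≤ (u * f t).re := hle
        _ ≤ ‖u * f t‖ := Complex.re_le_norm _
        _ = ‖u‖ * ‖f t‖ := norm_mul _ _
    · calc ‖f t‖ ≤ ∑ i, ‖μ i ^ 2‖ := by rw [hfμ]; exact norm_sum_le _ _
        _ = ∑ i, ‖μ i‖ ^ 2 := by simp only [norm_pow]
        _ ≤ (u * f t).re := hle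
  rcases exists_eq_pow_two_mul_of_norm_le_re hfa (key.mono fun t ⟨_, _, _, h⟩ => h) with
    hz | ⟨m, g, hg, hg0, hfg⟩
  · left
    refine linearSplit_of_coeff_eq_zero hq ?_
    filter_upwards [key, tendsto_ofReal_nhdsNE_zero.eventually (hz.filter_mono nhdsWithin_le_nhds)]
      with t ⟨μ, hμ, hle, _⟩ hz k hk
    have : ∀ i, μ i = 0 := fun i => by
      have := hle i
      rw [hz, norm_zero, mul_zero] at this
      exact norm_eq_zero.1 (pow_eq_zero_iff two_ne_zero |>.1 (le_antisymm this (sq_nonneg _)))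
    rw [hμ]
    simp [this, coeff_X_pow, hk.ne]
  right
  -- Since `f t = t ^ (2 * m) * g t`, this `K` will bound every root by `K * |t| ^ m`.
  obtain ⟨K, hK0, hK⟩ : ∃ K : ℝ, 0 ≤ K ∧ ∀ᶠ t : ℝ in 𝓝[≠] 0, ‖u‖ * ‖g t‖ ≤ K ^ 2 := by
    refine ⟨Real.sqrt (‖u‖ * ‖g 0‖ + 1), Real.sqrt_nonneg _, ?_⟩
    rw [Real.sq_sqrt (by positivity)]
    have : Tendsto (fun t : ℝ => ‖u‖ * ‖g t‖) (𝓝[≠] 0) (𝓝 (‖u‖ * ‖g 0‖)) :=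
      (((hg.continuousAt.tendsto.mono_left nhdsWithin_le_nhds).comp
        tendsto_ofReal_nhdsNE_zero).norm).const_mul _
    exact (this.eventually (gt_mem_nhds (lt_add_one _))).mono fun t ht => ht.le
  -- The coefficient of index `k` is, up to sign, an elementary symmetric function of degree `n + 2
  -- - k` in roots of size `O(|t| ^ m)`.
  have hb : ∀ k : Fin (n + 2), ∃ b : ℂ → ℂ, AnalyticAt ℂ b 0 ∧
      ∀ᶠ t in 𝓝 (0 : ℂ), (q t).coeff k = t ^ (m * (n + 2 - k)) * b t := by
    intro k
    refine exists_eq_pow_mul_of_norm_le (hq.analyticAt k)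
      (K := K ^ (n + 2 - (k : ℕ)) * (n + 2).choose k) ?_
    filter_upwards [key, hK, tendsto_ofReal_nhdsNE_zero.eventually
      (hfg.filter_mono nhdsWithin_le_nhds)] with t ⟨μ, hμ, hle, _⟩ hK hfg
    have hB : ∀ i, ‖μ i‖ ≤ K * |t| ^ m := fun i => by
      refine le_of_sq_le_sq ?_ (by positivity)
      calc ‖μ i‖ ^ 2 ≤ ‖u‖ * ‖f t‖ := hle i
        _ = (‖u‖ * ‖g t‖) * (|t| ^ m) ^ 2 := by
          rw [hfg, norm_mul, norm_pow, Complex.norm_real, Real.norm_eq_abs]; ring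
        _ ≤ K ^ 2 * (|t| ^ m) ^ 2 := by gcongr
        _ = (K * |t| ^ m) ^ 2 := by ring
    rw [hμ]
    refine (norm_coeff_prod_X_sub_C_le hB k).trans_eq ?_
    rw [mul_pow, ← pow_mul]
    ring
  choose b hba hbe using hb
  have hr : MonicFamily (n + 2) fun t => monicPoly (n + 2) fun i => b i t :=
    monicFamily_monicPoly (analyticAt_pi_iff.2 hba)
  have hbe' : ∀ᶠ t in 𝓝 (0 : ℂ), ∀ k : Fin (n + 2),
      (q t).coeff k = t ^ (m * (n + 2 - k)) * b k t := eventually_all.2 hbe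
  refine ⟨m, _, hr, ?_, ?_⟩
  -- The roots still have sum zero, so `c = 0`; but then the coefficient of index `n` would vanish
  -- at `0`, while it is `-g 0 / 2`.
  · intro c hc
    have hlim : ∀ {v w : ℂ → ℂ}, AnalyticAt ℂ v 0 → AnalyticAt ℂ w 0 →
        (∀ᶠ t in 𝓝[≠] (0 : ℂ), v t = w t) → v 0 = w 0 := fun hv hw h =>
      tendsto_nhds_unique ((hv.continuousAt.tendsto.mono_left nhdsWithin_le_nhds).congr' h)
        (hw.continuousAt.tendsto.mono_left nhdsWithin_le_nhds)
    have hcoeff : ∀ i : Fin (n + 2), b i 0 = (-c) ^ (n + 2 - (i : ℕ)) * ((n + 2).choose i : ℂ) := by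
      intro i
      have h1 := congrArg (fun P => P.coeff (i : ℕ)) hc
      simp only [coeff_monicPoly, i.2.ne, i.2, sub_eq_add_neg, ← C_neg, coeff_X_add_C_pow,
        if_false, dif_pos, zero_add] at h1
      exact h1
    have h1 : b ⟨n + 1, by omega⟩ 0 = 0 := by
      refine hlim (hba _) analyticAt_const (w := fun _ => 0) ?_
      filter_upwards [hbe'.filter_mono nhdsWithin_le_nhds, self_mem_nhdsWithin] with t ht htne
      have := ht ⟨n + 1, by omega⟩
      rw [h0] at this
      exact (mul_eq_zero.1 this.symm).resolve_left (pow_ne_zero _ htne)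
    have hc0 : c = 0 := by
      rw [hcoeff] at h1
      have h2 : n + 2 - (n + 1) = 1 := by omega
      rw [h2, pow_one] at h1
      refine neg_eq_zero.1 ((mul_eq_zero.1 h1).resolve_right ?_)
      exact_mod_cast (Nat.choose_pos (by omega : n + 1 ≤ n + 2)).ne'
    have h2 : b ⟨n, by omega⟩ 0 = 0 := by
      rw [hcoeff, hc0]
      simp
    apply hg0
    have h3 : g 0 = -2 * b ⟨n, by omega⟩ 0 := by
      refine hlim hg (analyticAt_const.mul (hba _)) ?_
      filter_upwards [hbe'.filter_mono nhdsWithin_le_nhds, hfg.filter_mono nhdsWithin_le_nhds,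
        self_mem_nhdsWithin] with t ht hfg htne
      have h4 := ht ⟨n, by omega⟩
      have h5 : m * (n + 2 - n) = 2 * m := by rw [Nat.add_sub_cancel_left, mul_comm]
      simp only [h5] at h4
      simp only [hf, h4] at hfg
      refine mul_left_cancel₀ (pow_ne_zero (2 * m) htne) ?_
      rw [← hfg, Pi.mul_apply]
      ring
    rw [h3, h2, mul_zero]
  · filter_upwards [hbe'] with t ht
    ext k
    rw [coeff_scaleRoots, hr.natDegree]
    rcases lt_trichotomy k (n + 2) with hk | hk | hk
    · rw [coeff_monicPoly, dif_pos hk, if_neg hk.ne, zero_add, ← pow_mul, mul_comm]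
      exact ht ⟨k, hk⟩
    · have h1 := (hq.monic t).coeff_natDegree
      have h2 := (hr.monic t).coeff_natDegree
      rw [hq.natDegree] at h1
      rw [hr.natDegree] at h2
      rw [hk, h1, h2]
      simp
    · rw [coeff_eq_zero_of_natDegree_lt (by rwa [hq.natDegree]),
        coeff_eq_zero_of_natDegree_lt (by rwa [hr.natDegree]), zero_mul]

/-- Rellich's theorem under the cone condition. -/
theorem RootCone.linearSplit {d : ℕ} {u : ℂ} {p : ℂ → ℂ[X]} (hp : MonicFamily d p)
    (hu : RootCone u p) : LinearSplit p := by
  induction d using Nat.strong_induction_on generalizing p with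
  | _ d ih =>
  match d, ih, hp with
  | 0, _, hp =>
    exact linearSplit_of_coeff_eq_zero hp (Eventually.of_forall fun t k hk => absurd hk (by simp))
  | 1, _, hp =>
    refine ⟨{fun t => -(p t).coeff 0}, ?_, Eventually.of_forall fun t => ?_⟩
    · intro f hf
      rw [Multiset.mem_singleton.1 hf]
      exact (hp.analyticAt 0).neg
    · simpa using (hp.monic t).eq_X_add_C (hp.natDegree t)
  | n + 2, ih, hp =>
    set a : ℂ → ℂ := fun t => -((p t).coeff (n + 1)) / (n + 2) with ha
    have haa : AnalyticAt ℂ a 0 := (hp.analyticAt (n + 1)).neg.div_const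
    have hq := hp.comp_X_add_C haa
    have hqu := hu.comp_X_add_C a
    have hq0 : ∀ t, ((p t).comp (X + C (a t))).coeff (n + 1) = 0 := fun t =>
      coeff_comp_X_add_C_eq_zero (hp.monic t) (hp.natDegree t)
    have hcomp : ∀ t, ((p t).comp (X + C (a t))).comp (X - C (a t)) = p t := fun t => by
      simp [comp_assoc]
    suffices h : LinearSplit fun t => (p t).comp (X + C (a t)) by
      refine h.transform (s := fun _ => 1) analyticAt_const haa (Eventually.of_forall fun t => ?_)
      rw [scaleRoots_one, hcomp]
    rcases hqu.linearSplit_or_exists_scaleRoots hq hq0 with h | ⟨m, r, hr, hne, he⟩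
    · exact h
    have hru : RootCone u r := hqu.of_scaleRoots he
    obtain ⟨d₁, d₂, hd₁, hd₂, r₁, r₂, hr₁, hr₂, hrr⟩ := hr.exists_factorization_of_ne_pow hne
    obtain ⟨hu₁, hu₂⟩ := hru.of_mul hrr
    have hs : LinearSplit r := (ih d₁ hd₁ hr₁ hu₁).of_mul (ih d₂ hd₂ hr₂ hu₂) hrr
    refine hs.transform (s := fun t => t ^ m) (a := fun _ => 0) (by fun_prop) analyticAt_const ?_
    filter_upwards [he] with t ht
    rw [ht]
    simp

/-! ### Rellich's theorem for roots on the unit circle -/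

theorem sub_sq_eq_of_norm_eq_one {x y : ℂ} (hx : ‖x‖ = 1) (hy : ‖y‖ = 1) :
    (x - y) ^ 2 = -(x * y * (‖x - y‖ ^ 2 : ℝ)) := by
  have h1 : x * (starRingEnd ℂ) x = 1 := by rw [Complex.mul_conj']; simp [hx]
  have h2 : y * (starRingEnd ℂ) y = 1 := by rw [Complex.mul_conj']; simp [hy]
  have h3 : ((‖x - y‖ ^ 2 : ℝ) : ℂ) = (x - y) * (starRingEnd ℂ) (x - y) := by
    rw [Complex.mul_conj']; norm_cast
  rw [h3, map_sub]
  linear_combination (x * y - y ^ 2) * h1 + (x * y - x ^ 2) * h2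

/-- With `p 0 = (X - C c) ^ d`, a root `x` of `p t` on the circle has `‖x - c‖ ^ d = ‖(p 0).eval
x‖`, so this gives continuity of the roots at `c`. -/
theorem MonicFamily.tendsto_eval_sub {d : ℕ} {p : ℂ → ℂ[X]} (hp : MonicFamily d p) {δ : ℝ}
    (hδ : 0 < δ) : ∀ᶠ t in 𝓝 (0 : ℂ), ∀ x : ℂ, ‖x‖ = 1 → ‖(p t).eval x - (p 0).eval x‖ < δ := by
  have h1 : Tendsto (fun t => ∑ k ∈ Finset.range (d + 1), ‖(p t).coeff k - (p 0).coeff k‖)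
      (𝓝 0) (𝓝 0) := by
    have : Tendsto (fun t => ∑ k ∈ Finset.range (d + 1), ‖(p t).coeff k - (p 0).coeff k‖)
        (𝓝 0) (𝓝 (∑ k ∈ Finset.range (d + 1), ‖(p 0).coeff k - (p 0).coeff k‖)) :=
      tendsto_finsetSum _ fun k _ => ((hp.analyticAt k).continuousAt.tendsto.sub_const _).norm
    simpa using this
  filter_upwards [h1.eventually (gt_mem_nhds hδ)] with t ht x hx
  refine lt_of_le_of_lt ?_ ht
  rw [eval_eq_sum_range, eval_eq_sum_range, hp.natDegree, hp.natDegree, ← Finset.sum_sub_distrib]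
  refine (norm_sum_le _ _).trans_eq (Finset.sum_congr rfl fun k _ => ?_)
  rw [← sub_mul, norm_mul, norm_pow, hx, one_pow, mul_one]

/-- Rellich's theorem for polynomials with roots on the unit circle. -/
theorem MonicFamily.linearSplit {d : ℕ} {p : ℂ → ℂ[X]} (hp : MonicFamily d p)
    (h : ∀ᶠ t : ℝ in 𝓝 0, ∀ x : ℂ, (p t).IsRoot x → ‖x‖ = 1) : LinearSplit p := by
  have hcoe : Tendsto (fun t : ℝ => (t : ℂ)) (𝓝 0) (𝓝 0) := by
    have := Complex.continuous_ofReal.tendsto 0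
    rwa [Complex.ofReal_zero] at this
  induction d using Nat.strong_induction_on generalizing p with
  | _ d ih =>
  by_cases hne : ∀ c : ℂ, p 0 ≠ (X - C c) ^ d
  · obtain ⟨d₁, d₂, hd₁, hd₂, p₁, p₂, hp₁, hp₂, he⟩ := hp.exists_factorization_of_ne_pow hne
    refine (ih d₁ hd₁ hp₁ ?_).of_mul (ih d₂ hd₂ hp₂ ?_) he
    · filter_upwards [h, hcoe.eventually he] with t ht he x hx
      exact ht x (he ▸ root_mul_right_of_isRoot _ hx)
    · filter_upwards [h, hcoe.eventually he] with t ht he x hx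
      exact ht x (he ▸ root_mul_left_of_isRoot _ hx)
  push Not at hne
  obtain ⟨c, hc⟩ := hne
  rcases Nat.eq_zero_or_pos d with rfl | hd
  · exact linearSplit_of_coeff_eq_zero hp (Eventually.of_forall fun t k hk => absurd hk (by simp))
  have hc1 : ‖c‖ = 1 := by
    refine h.self_of_nhds c ?_
    rw [Complex.ofReal_zero, hc]
    simp [hd.ne']
  -- Then `u * (x - y) ^ 2 = 2 * ‖x - y‖ ^ 2 * (conj c ^ 2 * (x * y))` on the circle, and the last
  -- factor has real part above `1 / 2` for `x`, `y` near `c`.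
  set u : ℂ := -2 * (starRingEnd ℂ) c ^ 2 with hu
  have hcone : ∀ᶠ z : ℂ × ℂ in 𝓝 (c, c), (1 / 2 : ℝ) < ((starRingEnd ℂ) c ^ 2 * (z.1 * z.2)).re := by
    have hcont : ContinuousAt (fun z : ℂ × ℂ => ((starRingEnd ℂ) c ^ 2 * (z.1 * z.2)).re) (c, c) := by
      fun_prop
    refine hcont.eventually (lt_mem_nhds ?_)
    have : (starRingEnd ℂ) c ^ 2 * (c * c) = (c * (starRingEnd ℂ) c) ^ 2 := by ring
    simp only [this, Complex.mul_conj', hc1]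
    norm_num
  obtain ⟨δ, hδ, hball⟩ := Metric.eventually_nhds_iff_ball.1 hcone
  refine RootCone.linearSplit (u := u) hp ?_
  refine Eventually.filter_mono nhdsWithin_le_nhds ?_
  filter_upwards [h, hcoe.eventually (hp.tendsto_eval_sub (pow_pos hδ d))] with t h1 h2 x y hx hy
  have hclose : ∀ x, (p t).IsRoot x → dist x c < δ := fun x hx => by
    have h3 := h2 x (h1 x hx)
    rw [hx.eq_zero, zero_sub, norm_neg, hc, eval_pow, norm_pow] at h3
    rw [dist_eq_norm]
    simpa using lt_of_pow_lt_pow_left₀ d hδ.le h3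
  have h4 := hball (x, y) (by
    rw [Metric.mem_ball, Prod.dist_eq]
    exact max_lt (hclose x hx) (hclose y hy))
  have h5 : u * (x - y) ^ 2 =
      ((2 * ‖x - y‖ ^ 2 : ℝ) : ℂ) * ((starRingEnd ℂ) c ^ 2 * (x * y)) := by
    rw [sub_sq_eq_of_norm_eq_one (h1 x hx) (h1 y hy), hu]
    push_cast
    ring
  rw [h5, Complex.re_ofReal_mul]
  nlinarith [sq_nonneg ‖x - y‖]

/-! ### Uniqueness and gluing of analytic roots along the real axis -/

/-- Near the point `z`, the `lam i` are analytic functions whose values are the roots of `P`. -/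
def RootsNear {d : ℕ} (P : ℂ → ℂ[X]) (z : ℂ) (lam : Fin d → ℂ → ℂ) : Prop :=
  (∀ i, AnalyticAt ℂ (lam i) z) ∧ ∀ᶠ t in 𝓝 z, P t = ∏ i, (X - C (lam i t))

namespace RootsNear

variable {d : ℕ} {P : ℂ → ℂ[X]} {z : ℂ} {lam mu : Fin d → ℂ → ℂ}

theorem congr (h : RootsNear P z lam) (he : ∀ i, mu i =ᶠ[𝓝 z] lam i) : RootsNear P z mu := by
  refine ⟨fun i => (h.1 i).congr (he i).symm, ?_⟩
  filter_upwards [h.2, eventually_all.2 he] with t h1 h2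
  rw [h1]
  exact Finset.prod_congr rfl fun i _ => by rw [h2 i]

theorem perm (h : RootsNear P z lam) (σ : Equiv.Perm (Fin d)) :
    RootsNear P z fun i => lam (σ i) := by
  refine ⟨fun i => h.1 (σ i), ?_⟩
  filter_upwards [h.2] with t h1
  rw [h1]
  exact (Equiv.prod_comp σ fun i => X - C (lam i t)).symm

theorem comp_add (h : RootsNear P z lam) {w c : ℂ} (hw : w + c = z) (hP : ∀ t, P (t + c) = P t) :
    RootsNear P w fun i t => lam i (t + c) := by
  have hc : Tendsto (fun t => t + c) (𝓝 w) (𝓝 z) := by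
    have : ContinuousAt (fun t : ℂ => t + c) w := by fun_prop
    rw [← hw]
    exact this.tendsto
  refine ⟨fun i => AnalyticAt.fun_comp (by rw [hw]; exact h.1 i) (by fun_prop), ?_⟩
  filter_upwards [hc.eventually h.2] with t ht
  rw [← hP, ht]

theorem eventually (h : RootsNear P z lam) : ∀ᶠ w in 𝓝 z, RootsNear P w lam := by
  filter_upwards [eventually_all.2 fun i => (h.1 i).eventually_analyticAt,
    eventually_eventually_nhds.2 h.2] with w h1 h2 using ⟨h1, h2⟩

end RootsNear

theorem exists_perm_of_prod_X_sub_C_eq {d : ℕ} {μ ν : Fin d → ℂ}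
    (h : ∏ i, (X - C (μ i)) = ∏ i, (X - C (ν i))) : ∃ σ : Equiv.Perm (Fin d), ∀ i, μ i = ν (σ i) := by
  classical
  have h1 : Finset.univ.val.map μ = Finset.univ.val.map ν := by
    rw [← roots_multiset_prod_X_sub_C (Finset.univ.val.map μ),
      ← roots_multiset_prod_X_sub_C (Finset.univ.val.map ν), Multiset.map_map, Multiset.map_map]
    exact congrArg roots h
  have h2 : ∀ c, Nonempty ({i // μ i = c} ≃ {i // ν i = c}) := fun c => by
    rw [← Fintype.card_eq, Fintype.card_subtype, Fintype.card_subtype]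
    have := congrArg (Multiset.count c) h1
    rw [Multiset.count_map, Multiset.count_map] at this
    simp only [eq_comm (a := c)] at this
    exact this
  refine ⟨Equiv.ofFiberEquiv fun c => (h2 c).some, fun i => ?_⟩
  exact (Equiv.ofFiberEquiv_map (f := μ) (g := ν) (fun c => (h2 c).some) i).symm

/-- Analytic roots are unique up to a permutation. -/
theorem exists_perm_of_frequently_eq {d : ℕ} {z : ℂ} {lam mu : Fin d → ℂ → ℂ}
    (hl : ∀ i, AnalyticAt ℂ (lam i) z) (hm : ∀ i, AnalyticAt ℂ (mu i) z)
    (h : ∃ᶠ t in 𝓝[≠] z, ∏ i, (X - C (lam i t)) = ∏ i, (X - C (mu i t))) :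
    ∃ σ : Equiv.Perm (Fin d), ∀ i, lam i =ᶠ[𝓝 z] mu (σ i) := by
  -- Two analytic germs coincide or differ throughout a punctured neighbourhood, so a matching of
  -- values at one suitable point is a matching of germs.
  have h1 : ∀ i j, ∀ᶠ t in 𝓝[≠] z, lam i t = mu j t → lam i =ᶠ[𝓝 z] mu j := fun i j => by
    rcases (hl i).eventually_eq_or_eventually_ne (hm j) with h | h
    · exact Eventually.of_forall fun _ _ => h
    · exact h.mono fun t ht he => absurd he ht
  obtain ⟨t, ht, h2⟩ := (h.and_eventually
    (eventually_all.2 fun i => eventually_all.2 fun j => h1 i j)).exists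
  obtain ⟨σ, hσ⟩ := exists_perm_of_prod_X_sub_C_eq ht
  exact ⟨σ, fun i => h2 i _ (hσ i)⟩

theorem RootsNear.exists_perm {d : ℕ} {P : ℂ → ℂ[X]} {z : ℂ} {lam mu : Fin d → ℂ → ℂ}
    (hl : RootsNear P z lam) (hm : RootsNear P z mu) :
    ∃ σ : Equiv.Perm (Fin d), ∀ i, lam i =ᶠ[𝓝 z] mu (σ i) :=
  exists_perm_of_frequently_eq hl.1 hm.1
    (((hl.2.and hm.2).filter_mono nhdsWithin_le_nhds).mono fun _ h => h.1.symm.trans h.2).frequently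

/-- A family of monic polynomials, analytic along the real axis, with roots on the unit circle for
real parameters has analytic roots near every real point. -/
theorem exists_rootsNear {d : ℕ} {P : ℂ → ℂ[X]} (hmonic : ∀ t, (P t).Monic)
    (hdeg : ∀ t, (P t).natDegree = d)
    (hanal : ∀ (t : ℝ) (k : ℕ), AnalyticAt ℂ (fun s => (P s).coeff k) t)
    (hroots : ∀ (t : ℝ) (x : ℂ), (P t).IsRoot x → ‖x‖ = 1) (t : ℝ) :
    ∃ lam : Fin d → ℂ → ℂ, RootsNear P t lam := by
  have hp : MonicFamily d fun s => P (s + t) := ⟨fun s => hmonic _, fun s => hdeg _, fun k =>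
    AnalyticAt.fun_comp (g := fun s => (P s).coeff k) (by rw [zero_add]; exact hanal t k)
      (by fun_prop)⟩
  obtain ⟨L, hL, he⟩ := hp.linearSplit (Eventually.of_forall fun s x hx =>
    hroots (s + t) x (by rwa [Complex.ofReal_add]))
  have hcard : L.toList.length = d := by
    have h0 : P (0 + t) = (L.map fun f => X - C (f 0)).prod := he.self_of_nhds
    rw [← hdeg (0 + t), h0, Multiset.length_toList,
      ← Multiset.card_map (fun f : ℂ → ℂ => f 0) L,
      ← natDegree_multiset_prod_X_sub_C_eq_card, Multiset.map_map]
    rfl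
  subst hcard
  have hnear : RootsNear (fun s => P (s + t)) 0 L.toList.get := by
    refine ⟨fun i => hL _ (Multiset.mem_toList.1 (List.get_mem _ i)), ?_⟩
    filter_upwards [he] with s hs
    rw [hs]
    conv_lhs => rw [← Multiset.coe_toList L, Multiset.map_coe, Multiset.prod_coe]
    rw [← List.prod_ofFn]
    congr 1
    conv_lhs => rw [← List.ofFn_get L.toList, List.map_ofFn]
    rfl
  refine ⟨fun i s => L.toList.get i (s + -t), fun i => AnalyticAt.fun_comp ?_ (by fun_prop), ?_⟩
  · rw [add_neg_cancel]
    exact hnear.1 i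
  · have hc : Tendsto (fun s : ℂ => s + -t) (𝓝 (t : ℂ)) (𝓝 0) := by
      have : ContinuousAt (fun s : ℂ => s + -t) t := by fun_prop
      simpa using this.tendsto
    filter_upwards [hc.eventually hnear.2] with s hs
    rw [← hs]
    congr 1
    ring

theorem eventually_re_lt {t b : ℝ} (h : t < b) : ∀ᶠ s in 𝓝 (t : ℂ), s.re < b := by
  have : ContinuousAt Complex.re (t : ℂ) := Complex.continuous_re.continuousAt
  exact this.eventually (gt_mem_nhds (by simpa using h))

theorem eventually_lt_re {t b : ℝ} (h : b < t) : ∀ᶠ s in 𝓝 (t : ℂ), b < s.re := by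
  have : ContinuousAt Complex.re (t : ℂ) := Complex.continuous_re.continuousAt
  exact this.eventually (lt_mem_nhds (by simpa using h))

/-- Analytic roots on two adjacent intervals can be glued. -/
theorem RootsNear.glue {d : ℕ} {P : ℂ → ℂ[X]} {a b c : ℝ} {lam mu : Fin d → ℂ → ℂ}
    (hab : a ≤ b) (hbc : b ≤ c) (hl : ∀ t ∈ Set.Icc a b, RootsNear P (t : ℝ) lam)
    (hm : ∀ t ∈ Set.Icc b c, RootsNear P (t : ℝ) mu) :
    ∃ nu : Fin d → ℂ → ℂ, ∀ t ∈ Set.Icc a c, RootsNear P (t : ℝ) nu := by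
  obtain ⟨σ, hσ⟩ := (hl b ⟨hab, le_rfl⟩).exists_perm (hm b ⟨le_rfl, hbc⟩)
  refine ⟨fun i t => if t.re ≤ b then lam i t else mu (σ i) t, fun t ht => ?_⟩
  rcases lt_trichotomy t b with h | h | h
  · refine (hl t ⟨ht.1, h.le⟩).congr fun i => ?_
    filter_upwards [eventually_re_lt h] with s hs
    rw [if_pos hs.le]
  · subst h
    refine (hl t ⟨hab, le_rfl⟩).congr fun i => ?_
    filter_upwards [hσ i] with s hs
    rw [← hs, ite_self]
  · refine ((hm t ⟨h.le, ht.2⟩).perm σ).congr fun i => ?_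
    filter_upwards [eventually_lt_re h] with s hs
    rw [if_neg hs.not_ge]

theorem exists_rootsNear_Icc {d : ℕ} {P : ℂ → ℂ[X]}
    (h : ∀ t : ℝ, ∃ lam : Fin d → ℂ → ℂ, RootsNear P t lam) {a b : ℝ} (hab : a ≤ b) :
    ∃ lam : Fin d → ℂ → ℂ, ∀ t ∈ Set.Icc a b, RootsNear P (t : ℝ) lam := by
  suffices H : ∃ lam : Fin d → ℂ → ℂ, ∀ t ∈ Set.uIcc a b, RootsNear P (t : ℝ) lam by
    rwa [Set.uIcc_of_le hab] at H
  -- Having analytic roots on the interval between two points is a local, transitive and symmetric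
  -- relation, so connectedness of the line gives it for all pairs.
  refine isPreconnected_univ.induction₂
    (fun a b : ℝ => ∃ lam : Fin d → ℂ → ℂ, ∀ t ∈ Set.uIcc a b, RootsNear P (t : ℝ) lam)
    ?_ ?_ ?_ (Set.mem_univ a) (Set.mem_univ b)
  · intro x _
    rw [nhdsWithin_univ]
    obtain ⟨lam, hlam⟩ := h x
    obtain ⟨ε, hε, hball⟩ := Metric.eventually_nhds_iff_ball.1
      (Complex.continuous_ofReal.continuousAt.eventually hlam.eventually)
    filter_upwards [Metric.ball_mem_nhds x hε] with y hy
    exact ⟨lam, fun t ht => hball t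
      ((convex_ball x ε).ordConnected.uIcc_subset (Metric.mem_ball_self hε) hy ht)⟩
  · rintro x y z - - - ⟨lam, hl⟩ ⟨mu, hm⟩
    have hmono : ∀ {a b : ℝ} {c e : ℝ} {nu : Fin d → ℂ → ℂ},
        (∀ t ∈ Set.uIcc a b, RootsNear P (t : ℝ) nu) → c ∈ Set.uIcc a b → e ∈ Set.uIcc a b →
        ∃ nu : Fin d → ℂ → ℂ, ∀ t ∈ Set.uIcc c e, RootsNear P (t : ℝ) nu :=
      fun {a b c e nu} h hc he => ⟨nu, fun t ht => h t (Set.uIcc_subset_uIcc hc he ht)⟩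
    by_cases hxz : z ∈ Set.uIcc x y
    · exact hmono hl Set.left_mem_uIcc hxz
    by_cases hzx : x ∈ Set.uIcc y z
    · exact hmono hm hzx Set.right_mem_uIcc
    rw [Set.mem_uIcc] at hxz hzx
    push Not at hxz hzx
    rcases le_total x y with h1 | h1
    · have h2 : y ≤ z := (hxz.1 (by by_contra! h2; have := hzx.2 h2.le; linarith)).le
      rw [Set.uIcc_of_le h1] at hl
      rw [Set.uIcc_of_le h2] at hm
      rw [Set.uIcc_of_le (h1.trans h2)]
      exact RootsNear.glue h1 h2 hl hm
    · have h2 : z ≤ y := by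
        by_contra! h2
        have h3 := hzx.1 h1
        have := hxz.2 h2.le
        linarith
      rw [Set.uIcc_of_ge h1] at hl
      rw [Set.uIcc_of_ge h2] at hm
      rw [Set.uIcc_of_ge (h2.trans h1)]
      exact RootsNear.glue h2 h1 hm hl
  · rintro x y - - ⟨lam, hl⟩
    exact ⟨lam, by rwa [Set.uIcc_comm]⟩

/-- Analytic roots of a periodic family along the whole real axis; a period permutes them. -/
theorem exists_rootsNear_periodic {d : ℕ} {P : ℂ → ℂ[X]}
    (h : ∀ t : ℝ, ∃ lam : Fin d → ℂ → ℂ, RootsNear P t lam) {T : ℝ} (hT : 0 < T)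
    (hP : ∀ t, P (t + T) = P t) :
    ∃ (nu : Fin d → ℂ → ℂ) (σ : Equiv.Perm (Fin d)), (∀ t : ℝ, RootsNear P t nu) ∧
      ∀ i t, nu i (t + T) = nu (σ i) t := by
  obtain ⟨lam, hlam⟩ := exists_rootsNear_Icc h hT.le
  have hlam0 : RootsNear P (0 : ℂ) lam := by simpa using hlam 0 ⟨le_rfl, hT.le⟩
  obtain ⟨σ, hσ⟩ := ((hlam T ⟨hT.le, le_rfl⟩).comp_add (w := 0) (by simp) hP).exists_perm hlam0
  have hPz : ∀ (k : ℤ) t, P (t + -(k * T)) = P t := by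
    have hper : Function.Periodic P (T : ℂ) := hP
    intro k t
    have := (hper.int_mul (-k)) t
    simpa using this
  -- Translate back to the strip `0 ≤ re < T` and correct the index by the monodromy `σ`, once for
  -- each period crossed.
  refine ⟨fun i t => lam ((σ ^ ⌊t.re / T⌋) i) (t + -(⌊t.re / T⌋ * T)), σ, fun t => ?_, fun i t => ?_⟩
  · set k : ℤ := ⌊t / T⌋ with hk
    set s : ℝ := t + -(k * T) with hs
    have hs0 : 0 ≤ s := by
      have := (le_div_iff₀ hT).1 (Int.floor_le (t / T))
      rw [hs]; linarith
    have hsT : s < T := by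
      have := (div_lt_iff₀ hT).1 (Int.lt_floor_add_one (t / T))
      rw [hs]; linarith
    have hts : (t : ℂ) + -(k * T) = s := by rw [hs]; push_cast; ring
    refine (((hlam s ⟨hs0, hsT.le⟩).comp_add hts (hPz k)).perm (σ ^ k)).congr fun i => ?_
    have hlt : ∀ᶠ w in 𝓝 (t : ℂ), w.re < (k + 1) * T := eventually_re_lt (by rw [hs] at hsT; linarith)
    -- Only at multiples of `T` does the floor jump; there the branch with floor `k - 1` agrees with
    -- the one with floor `k` by `hσ`.
    rcases hs0.eq_or_lt with h0 | h0
    · have hgt : ∀ᶠ w in 𝓝 (t : ℂ), (k - 1) * T < w.re :=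
        eventually_lt_re (by rw [hs] at h0; linarith)
      have htend : Tendsto (fun w : ℂ => w + -(k * T)) (𝓝 (t : ℂ)) (𝓝 0) := by
        have h1 : ContinuousAt (fun w : ℂ => w + -(k * T)) t := by fun_prop
        have h2 := h1.tendsto
        rwa [hts, ← h0, Complex.ofReal_zero] at h2
      filter_upwards [hlt, hgt, htend.eventually (hσ ((σ ^ (k - 1)) i))] with w hlt hgt hw
      rcases le_or_gt (k * T) w.re with h1 | h1
      · have : ⌊w.re / T⌋ = k := by
          rw [Int.floor_eq_iff, le_div_iff₀ hT, div_lt_iff₀ hT]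
          exact ⟨h1, hlt⟩
        rw [this]
      · have : ⌊w.re / T⌋ = k - 1 := by
          rw [Int.floor_eq_iff, le_div_iff₀ hT, div_lt_iff₀ hT]
          push_cast
          exact ⟨hgt.le, by linarith⟩
        rw [this]
        have h2 : (σ ^ k) i = σ ((σ ^ (k - 1)) i) := by
          rw [← Equiv.Perm.mul_apply, ← zpow_one_add, add_sub_cancel]
        rw [h2, ← hw]
        congr 1
        push_cast
        ring
    · have hgt : ∀ᶠ w in 𝓝 (t : ℂ), k * T < w.re := eventually_lt_re (by rw [hs] at h0; linarith)
      filter_upwards [hlt, hgt] with w hlt hgt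
      have : ⌊w.re / T⌋ = k := by
        rw [Int.floor_eq_iff, le_div_iff₀ hT, div_lt_iff₀ hT]
        exact ⟨hgt.le, hlt⟩
      rw [this]
  · have h1 : ⌊(t + T).re / T⌋ = ⌊t.re / T⌋ + 1 := by
      rw [Complex.add_re, Complex.ofReal_re, add_div, div_self hT.ne', Int.floor_add_one]
    simp only [h1]
    rw [← Equiv.Perm.mul_apply, ← zpow_add_one]
    congr 1
    push_cast
    ring

/-! ### Functions on the circle and `2π`-periodic functions -/

/-- The function on the punctured plane induced by a `2π`-periodic function. -/
noncomputable def circ (f : ℂ → ℂ) (w : ℂ) : ℂ := f (Complex.log w / Complex.I)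

theorem circ_exp {f : ℂ → ℂ} (hf : ∀ t, f (t + (2 * Real.pi : ℝ)) = f t) (s : ℂ) :
    circ f (Complex.exp (s * Complex.I)) = f s := by
  have hper : Function.Periodic f ((2 * Real.pi : ℝ) : ℂ) := hf
  have h1 : Complex.exp (Complex.log (Complex.exp (s * Complex.I))) =
      Complex.exp (s * Complex.I) := Complex.exp_log (Complex.exp_ne_zero _)
  obtain ⟨n, hn⟩ := Complex.exp_eq_exp_iff_exists_int.1 h1
  rw [circ, hn, ← hper.int_mul n s]
  congr 1
  push_cast
  field_simp

theorem exists_eq_exp (z : Circle) : ∃ t : ℝ, (z : ℂ) = Complex.exp (t * Complex.I) :=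
  ⟨(z : ℂ).arg, by rw [← Circle.coe_exp, Circle.exp_arg]⟩

theorem exists_eq_exp_of_mem_sphere {w : ℂ} (hw : w ∈ Metric.sphere (0 : ℂ) 1) :
    ∃ t : ℝ, w = Complex.exp (t * Complex.I) :=
  exists_eq_exp ⟨w, by simpa [Submonoid.unitSphere] using hw⟩

theorem exp_mem_sphere (t : ℝ) : Complex.exp (t * Complex.I) ∈ Metric.sphere (0 : ℂ) 1 := by
  simp [Complex.norm_exp_ofReal_mul_I]

theorem analyticOnNhd_circ {f : ℂ → ℂ} (hf : ∀ t, f (t + (2 * Real.pi : ℝ)) = f t)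
    (ha : ∀ t : ℝ, AnalyticAt ℂ f t) : AnalyticOnNhd ℂ (circ f) (Metric.sphere 0 1) := by
  intro w hw
  obtain ⟨t, rfl⟩ := exists_eq_exp_of_mem_sphere hw
  set z := Complex.exp (t * Complex.I) with hz
  have hz0 : z ≠ 0 := Complex.exp_ne_zero _
  -- `Complex.log` may jump at `z`; this branch is centred at `z`, and periodicity of `f` makes the
  -- choice of branch irrelevant.
  set s : ℂ → ℂ := fun w => t + Complex.log (w / z) / Complex.I with hs
  have hs0 : s z = t := by simp [hs, div_self hz0]
  have hsa : AnalyticAt ℂ s z := by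
    refine analyticAt_const.add (AnalyticAt.div_const (AnalyticAt.clog (by fun_prop) ?_))
    rw [div_self hz0]
    exact Complex.one_mem_slitPlane
  have hfs : AnalyticAt ℂ (fun w => f (s w)) z :=
    AnalyticAt.fun_comp (by rw [hs0]; exact ha t) hsa
  refine hfs.congr ?_
  filter_upwards [isOpen_ne.mem_nhds hz0] with w hw0
  rw [← circ_exp hf (s w)]
  congr 1
  rw [hs]
  simp only [add_mul, div_mul_cancel₀ _ Complex.I_ne_zero]
  rw [Complex.exp_add, Complex.exp_log (div_ne_zero hw0 hz0), ← hz]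
  field_simp

/-- Functions analytic on a neighbourhood of the circle. -/
noncomputable def analyticSubring : Subring (ℂ → ℂ) where
  carrier := {f | AnalyticOnNhd ℂ f (Metric.sphere 0 1)}
  mul_mem' := fun hf hg => AnalyticOnNhd.mul hf hg
  one_mem' := analyticOnNhd_const
  add_mem' := fun hf hg => AnalyticOnNhd.add hf hg
  zero_mem' := analyticOnNhd_const
  neg_mem' := fun hf => AnalyticOnNhd.neg hf

/-- The meromorphic function on the circle defined by an analytic function. -/
noncomputable def toQT : analyticSubring →+* QT :=
  ((Germ.coeRingHom puncturedNhds).comp analyticSubring.subtype).codRestrict subring fun f =>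
    ⟨f, fun z hz => (f.2 z hz).meromorphicAt, rfl⟩

theorem coe_toQT (f : analyticSubring) :
    (toQT f : Germ puncturedNhds ℂ) = ((f : ℂ → ℂ) : Germ puncturedNhds ℂ) := rfl

/-- Evaluation at a point. -/
noncomputable def evalAt (w : ℂ) : analyticSubring →+* ℂ :=
  (Pi.evalRingHom (fun _ : ℂ => ℂ) w).comp analyticSubring.subtype

theorem evalAt_apply (w : ℂ) (f : analyticSubring) : evalAt w f = (f : ℂ → ℂ) w := rfl

theorem tendsto_exp_nhdsNE (t : ℝ) {c : ℂ} (hc : c ≠ 0) :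
    Tendsto (fun s : ℝ => Complex.exp (c * s)) (𝓝[≠] t) (𝓝[≠] Complex.exp (c * t)) := by
  have h1 : HasDerivAt (fun s : ℝ => Complex.exp (c * s)) (Complex.exp (c * t) * (c * 1)) t := by
    have h2 : HasDerivAt (fun s : ℝ => c * (s : ℂ)) (c * 1) t := by
      simpa using (Complex.ofRealCLM.hasDerivAt (x := t)).const_mul c
    exact h2.cexp
  exact h1.tendsto_nhdsNE (mul_ne_zero (Complex.exp_ne_zero _) (by simpa using hc))

theorem frequently_mem_sphere {z : ℂ} (hz : z ∈ Metric.sphere (0 : ℂ) 1) {p : ℂ → Prop}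
    (h : ∀ᶠ w in 𝓝[≠] z, p w) : ∃ t : ℝ, p (Complex.exp (t * Complex.I)) := by
  obtain ⟨t, rfl⟩ := exists_eq_exp_of_mem_sphere hz
  have := tendsto_exp_nhdsNE t Complex.I_ne_zero
  simp only [mul_comm Complex.I] at this
  exact (this.eventually h).exists

/-- Analytic functions that do not agree near a point of the circle differ in a punctured
neighbourhood of it, which contains points of the circle. -/
theorem toQT_eq_toQT {f g : analyticSubring}
    (h : ∀ t : ℝ, evalAt (Complex.exp (t * Complex.I)) f = evalAt (Complex.exp (t * Complex.I)) g) :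
    toQT f = toQT g := by
  refine Subtype.ext ?_
  rw [coe_toQT, coe_toQT]
  refine Germ.coe_eq.mpr (eventually_iff.mpr fun z => ?_)
  rcases (f.2 z (coe_mem_sphere z)).eventually_eq_or_eventually_ne (g.2 z (coe_mem_sphere z)) with
    h1 | h1
  · exact h1.filter_mono nhdsWithin_le_nhds
  · obtain ⟨t, ht⟩ := frequently_mem_sphere (coe_mem_sphere z) h1
    exact absurd (h t) ht

theorem map_toQT_eq_map_toQT {p q : analyticSubring[X]}
    (h : ∀ t : ℝ, p.map (evalAt (Complex.exp (t * Complex.I))) =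
      q.map (evalAt (Complex.exp (t * Complex.I)))) : p.map toQT = q.map toQT := by
  ext1 k
  rw [coeff_map, coeff_map]
  refine toQT_eq_toQT fun t => ?_
  rw [← coeff_map, ← coeff_map, h t]

theorem hasValueAt_toQT (f : analyticSubring) (z : Circle) :
    HasValueAt (toQT f) z (evalAt z f) :=
  ⟨f, rfl, (f.2 z (coe_mem_sphere z)).continuousAt.tendsto.mono_left nhdsWithin_le_nhds⟩

theorem specializesTo_map_toQT (p : analyticSubring[X]) (z : Circle) :
    SpecializesTo (p.map toQT) z (p.map (evalAt z)) := fun k => by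
  rw [coeff_map, coeff_map]
  exact hasValueAt_toQT _ z

/-! ### Absence of poles -/

theorem SpecializesTo.unique {g : QT[X]} {z : Circle} {p q : ℂ[X]} (hp : SpecializesTo g z p)
    (hq : SpecializesTo g z q) : p = q :=
  Polynomial.ext fun k => (hp k).unique (hq k)

theorem specializesTo_monicPoly {g : QT[X]} (hg : g.Monic) {z : Circle} {c : Fin g.natDegree → ℂ}
    (hc : ∀ i : Fin g.natDegree, HasValueAt (g.coeff i) z (c i)) :
    SpecializesTo g z (monicPoly g.natDegree c) := by
  intro k
  have hconst : ∀ a : ℂ, HasValueAt (toQT ⟨fun _ => a, analyticOnNhd_const⟩) z a := fun a =>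
    hasValueAt_toQT ⟨fun _ => a, analyticOnNhd_const⟩ z
  rw [coeff_monicPoly]
  rcases lt_trichotomy k g.natDegree with h | h | h
  · rw [if_neg h.ne, dif_pos h, zero_add]
    exact hc ⟨k, h⟩
  · rw [if_pos h, dif_neg h.not_lt, add_zero, h, hg.coeff_natDegree]
    have h1 : toQT ⟨fun _ => 1, analyticOnNhd_const⟩ = 1 := map_one toQT
    exact h1 ▸ hconst 1
  · rw [if_neg h.ne', dif_neg h.not_gt, add_zero, coeff_eq_zero_of_natDegree_lt h]
    have h1 : toQT ⟨fun _ => 0, analyticOnNhd_const⟩ = 0 := map_zero toQT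
    exact h1 ▸ hconst 0

theorem norm_coeff_le_of_roots_mem_sphere {p : ℂ[X]} {d : ℕ} (hp : p.Monic) (hd : p.natDegree = d)
    (h : ∀ x, p.IsRoot x → x ∈ Metric.sphere (0 : ℂ) 1) (k : ℕ) : ‖p.coeff k‖ ≤ d.choose k := by
  obtain ⟨μ, hμ⟩ := exists_eq_prod_X_sub_C hp hd
  have := norm_coeff_prod_X_sub_C_le (μ := μ) (B := 1) (fun i => ?_) k
  · rw [hμ]
    simpa using this
  · have : p.IsRoot (μ i) := by
      rw [hμ, IsRoot, eval_prod]
      exact Finset.prod_eq_zero (Finset.mem_univ i) (by simp)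
    simpa using (h _ this).le

/-- A monic polynomial all of whose values have their roots on the circle has no poles. -/
theorem exists_map_toQT_eq {g : QT[X]} (hmonic : g.Monic)
    (hroots : ∀ (z : Circle) (p : ℂ[X]), SpecializesTo g z p →
      ∀ x : ℂ, p.IsRoot x → x ∈ Metric.sphere (0 : ℂ) 1) :
    ∃ G : analyticSubring[X], G.map toQT = g ∧ G.natDegree = g.natDegree ∧ G.Monic := by
  refine lifts_and_natDegree_eq_and_monic ((lifts_iff_coeff_lifts g).2 fun k => ?_) hmonic
  rcases lt_trichotomy k g.natDegree with hk | rfl | hk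
  rotate_left
  · exact ⟨1, by rw [map_one, hmonic.coeff_natDegree]⟩
  · exact ⟨0, by rw [map_zero, coeff_eq_zero_of_natDegree_lt hk]⟩
  choose f hf hfg using fun i => (g.coeff i).2
  -- Normal forms are taken so that nonnegative order means analyticity, with no value left to
  -- correct.
  set N : ℕ → ℂ → ℂ := fun i => toMeromorphicNFOn (f i) (Metric.sphere 0 1) with hN
  have hNf : ∀ i, (N i : Germ puncturedNhds ℂ) = g.coeff i := fun i => by
    rw [← hfg i]
    exact Germ.coe_eq.mpr (eventually_iff.mpr fun z =>
      (hf i).toMeromorphicNFOn_eq_self_on_nhdsNE (coe_mem_sphere z))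
  have hnf : ∀ i, MeromorphicNFOn (N i) (Metric.sphere 0 1) := fun i =>
    meromorphicNFOn_toMeromorphicNFOn _ _
  refine ⟨⟨N k, fun w hw => ?_⟩, Subtype.ext (hNf k)⟩
  rw [← (hnf k hw).meromorphicOrderAt_nonneg_iff_analyticAt]
  by_contra! hneg
  have htend := (tendsto_cobounded_iff_meromorphicOrderAt_neg (hnf k hw).meromorphicAt).2 hneg
  have hbig : ∀ᶠ z in 𝓝[≠] w, (g.natDegree.choose k : ℝ) < ‖N k z‖ :=
    (tendsto_norm_cobounded_atTop.comp htend).eventually (eventually_gt_atTop _)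
  have hanal : ∀ᶠ z in 𝓝[≠] w, ∀ i : Fin g.natDegree, AnalyticAt ℂ (N i) z :=
    eventually_all.2 fun i => (hnf i hw).meromorphicAt.eventually_analyticAt
  -- Near a supposed pole, choose a point of the circle where every lower coefficient is analytic
  -- but the `k`-th exceeds the binomial bound.
  obtain ⟨t, ht1, ht2⟩ := frequently_mem_sphere hw (hbig.and hanal)
  have hspec : SpecializesTo g (Circle.exp t)
      (monicPoly g.natDegree fun i => N i (Complex.exp (t * Complex.I))) := by
    refine specializesTo_monicPoly hmonic fun i => ⟨N i, hNf i, ?_⟩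
    rw [Circle.coe_exp]
    exact (ht2 i).continuousAt.tendsto.mono_left nhdsWithin_le_nhds
  have hle := norm_coeff_le_of_roots_mem_sphere (monicPoly_monic _ _) (natDegree_monicPoly _ _)
    (hroots _ _ hspec) k
  rw [coeff_monicPoly, if_neg hk.ne, dif_pos hk, zero_add] at hle
  exact absurd hle (not_le.2 ht1)

/-! ### Irreducibility and transitivity of the monodromy -/

/-- A periodic family of monic polynomials with analytic coefficients comes from a polynomial over
the analytic functions on the circle. -/
theorem exists_map_evalAt_eq {Q : ℂ → ℂ[X]} {n : ℕ} (hmonic : ∀ t, (Q t).Monic)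
    (hdeg : ∀ t, (Q t).natDegree = n) (hper : ∀ t, Q (t + (2 * Real.pi : ℝ)) = Q t)
    (hanal : ∀ (t : ℝ) (k : ℕ), AnalyticAt ℂ (fun s => (Q s).coeff k) t) :
    ∃ A : analyticSubring[X], A.Monic ∧ A.natDegree = n ∧
      ∀ t : ℂ, A.map (evalAt (Complex.exp (t * Complex.I))) = Q t := by
  have hcper : ∀ k t, (fun s => (Q s).coeff k) (t + (2 * Real.pi : ℝ)) =
      (fun s => (Q s).coeff k) t := fun k t => by simp only [hper]
  let a : ℕ → analyticSubring := fun k =>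
    ⟨circ fun s => (Q s).coeff k, analyticOnNhd_circ (hcper k) fun t => hanal t k⟩
  let A : analyticSubring[X] := ∑ k ∈ Finset.range (n + 1), monomial k (a k)
  have hcoeff : ∀ k, A.coeff k = a k := fun k => by
    simp only [A, finsetSum_coeff, coeff_monomial, Finset.sum_ite_eq', Finset.mem_range]
    split_ifs with hk
    · rfl
    · refine Subtype.ext (funext fun w => ?_)
      exact (coeff_eq_zero_of_natDegree_lt (by rw [hdeg]; omega)).symm
  have hn : A.coeff n = 1 := by
    rw [hcoeff]
    refine Subtype.ext (funext fun w => ?_)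
    have := (hmonic (Complex.log w / Complex.I)).coeff_natDegree
    rw [hdeg] at this
    exact this
  have hle : A.natDegree ≤ n := natDegree_sum_le_of_forall_le _ _ fun k hk =>
    (natDegree_monomial_le _).trans (by rw [Finset.mem_range] at hk; omega)
  refine ⟨A, monic_of_natDegree_le_of_coeff_eq_one n hle hn,
    natDegree_eq_of_le_of_coeff_ne_zero hle (by rw [hn]; exact one_ne_zero), fun t => ?_⟩
  ext k
  rw [coeff_map, hcoeff, evalAt_apply]
  exact circ_exp (f := fun s => (Q s).coeff k) (hcper k) t

theorem analyticAt_coeff_prod_X_sub_C {ι : Type*} {z : ℂ} {nu : ι → ℂ → ℂ} (S : Finset ι)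
    (h : ∀ i, AnalyticAt ℂ (nu i) z) (k : ℕ) :
    AnalyticAt ℂ (fun s => (∏ i ∈ S, (X - C (nu i s))).coeff k) z := by
  classical
  induction S using Finset.induction_on generalizing k with
  | empty => simpa using analyticAt_const
  | insert a s ha ih =>
    simp only [Finset.prod_insert ha, sub_mul, coeff_sub, coeff_C_mul]
    refine AnalyticAt.fun_sub ?_ ((h a).fun_mul (ih k))
    cases k with
    | zero => simpa using analyticAt_const
    | succ k => simpa using ih k

/-- If the roots of an irreducible polynomial over the field of meromorphic functions on the circle
are given by functions analytic along the universal cover, then the deck transformations permute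
them transitively. -/
theorem sameCycle_of_irreducible {G : analyticSubring[X]} {d : ℕ}
    (hirr : Irreducible (G.map toQT)) (hG : G.Monic) {nu : Fin d → ℂ → ℂ} {σ : Equiv.Perm (Fin d)}
    (hnu : ∀ (i : Fin d) (t : ℝ), AnalyticAt ℂ (nu i) t)
    (hprod : ∀ t : ℝ, G.map (evalAt (Complex.exp (t * Complex.I))) = ∏ i, (X - C (nu i t)))
    (hσ : ∀ i t, nu i (t + (2 * Real.pi : ℝ)) = nu (σ i) t) (i j : Fin d) : σ.SameCycle i j := by
  classical
  -- The product over a `σ`-stable set of indices is `2π`-periodic, hence lives on the circle. The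
  -- cycle of `i` and its complement will give complementary factors of `G`.
  have hfac : ∀ S : Finset (Fin d), (∀ i, i ∈ S ↔ σ i ∈ S) → ∃ A : analyticSubring[X],
      A.Monic ∧ A.natDegree = S.card ∧
      ∀ t : ℂ, A.map (evalAt (Complex.exp (t * Complex.I))) = ∏ i ∈ S, (X - C (nu i t)) := by
    intro S hS
    refine exists_map_evalAt_eq (fun t => monic_prod_of_monic _ _ fun i _ => monic_X_sub_C _)
      (fun t => natDegree_finsetProd_X_sub_C_eq_card _ _) (fun t => ?_) fun t k => ?_
    · simp only [hσ]
      exact Finset.prod_equiv σ hS fun i _ => rfl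
    · exact analyticAt_coeff_prod_X_sub_C S (fun i => hnu i t) k
  set S : Finset (Fin d) := Finset.univ.filter fun j => σ.SameCycle i j with hSdef
  have hS : ∀ j, j ∈ S ↔ σ j ∈ S := fun j => by
    simp [hSdef, Equiv.Perm.sameCycle_apply_right]
  obtain ⟨A, hA, hAd, hAe⟩ := hfac S hS
  obtain ⟨B, hB, hBd, hBe⟩ := hfac Sᶜ fun j => by
    rw [Finset.mem_compl, Finset.mem_compl, hS]
  have hAB : A.map toQT * B.map toQT = G.map toQT := by
    rw [← Polynomial.map_mul]
    refine map_toQT_eq_map_toQT fun t => ?_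
    rw [Polynomial.map_mul, hAe, hBe, hprod, Finset.prod_mul_prod_compl]
  have hiS : i ∈ S := Finset.mem_filter.2 ⟨Finset.mem_univ i, Equiv.Perm.SameCycle.refl σ i⟩
  rcases ((hG.map toQT).irreducible_iff_natDegree.1 hirr).2 _ _ (hA.map toQT) (hB.map toQT) hAB with
    h | h
  · rw [hA.natDegree_map, hAd, Finset.card_eq_zero] at h
    rw [h] at hiS
    simp at hiS
  · rw [hB.natDegree_map, hBd, Finset.card_eq_zero, Finset.compl_eq_empty_iff] at h
    have : j ∈ S := h ▸ Finset.mem_univ j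
    exact (Finset.mem_filter.1 this).2

/-! ### Existence and uniqueness of the parametrization -/

theorem prod_nthRootsFinset_exp {M : Type*} [CommMonoid M] {d : ℕ} (hd : d ≠ 0) (F : ℂ → M)
    (t : ℂ) : ∏ ζ ∈ nthRootsFinset d (Complex.exp (t * Complex.I)), F ζ =
      ∏ k : Fin d, F (Complex.exp ((t + k * (2 * Real.pi)) / d * Complex.I)) := by
  classical
  have hprim := Complex.isPrimitiveRoot_exp d hd
  have hd' : (d : ℂ) ≠ 0 := Nat.cast_ne_zero.2 hd
  have hpow : Complex.exp (t / d * Complex.I) ^ d = Complex.exp (t * Complex.I) := by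
    rw [← Complex.exp_nat_mul]
    congr 1
    field_simp
  rw [nthRootsFinset_def, Finset.prod, Multiset.toFinset_val,
    (hprim.nthRoots_nodup (Complex.exp_ne_zero _)).dedup, hprim.nthRoots_eq hpow, Multiset.map_map]
  refine Eq.trans ?_ (Finset.prod_range
    (fun k : ℕ => F (Complex.exp ((t + k * (2 * Real.pi)) / d * Complex.I))))
  refine congrArg Multiset.prod (Multiset.map_congr rfl fun k _ => ?_)
  rw [Function.comp_apply, ← Complex.exp_nat_mul, ← Complex.exp_add]
  congr 2
  field_simp
  ring

theorem analyticAt_comp_exp {f : ℂ → ℂ} (hf : AnalyticOnNhd ℂ f (Metric.sphere 0 1)) (d k : ℕ)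
    (t : ℝ) : AnalyticAt ℂ (fun s : ℂ =>
      f (Complex.exp ((s + k * (2 * Real.pi)) / d * Complex.I))) t := by
  refine AnalyticAt.fun_comp (hf _ ?_) (by fun_prop)
  have := exp_mem_sphere ((t + k * (2 * Real.pi)) / d)
  push_cast at this
  exact this

theorem exists_isEigenfunction {g : QT[X]} (hirr : Irreducible g) (hmonic : g.Monic)
    (hroots : ∀ (z : Circle) (p : ℂ[X]), SpecializesTo g z p →
      ∀ x : ℂ, p.IsRoot x → x ∈ Metric.sphere (0 : ℂ) 1) :
    ∃ lam : ℂ → ℂ, IsEigenfunction g g.natDegree lam := by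
  obtain ⟨G, rfl, hdeg, hG⟩ := exists_map_toQT_eq hmonic hroots
  set d := (G.map toQT).natDegree with hd
  have hd0 : 0 < d := hmonic.natDegree_pos_of_not_isUnit hirr.not_isUnit
  set P : ℂ → ℂ[X] := fun t => G.map (evalAt (Complex.exp (t * Complex.I))) with hP
  have hPper : ∀ t, P (t + (2 * Real.pi : ℝ)) = P t := fun t => by
    simp only [hP]
    congr 2
    rw [add_mul, Complex.ofReal_mul, Complex.ofReal_ofNat, Complex.exp_add,
      Complex.exp_two_pi_mul_I, mul_one]
  have hspec : ∀ t : ℝ, SpecializesTo (G.map toQT) (Circle.exp t) (P t) := fun t => by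
    have := specializesTo_map_toQT G (Circle.exp t)
    rwa [Circle.coe_exp] at this
  have hlocal : ∀ t : ℝ, ∃ lam : Fin d → ℂ → ℂ, RootsNear P t lam := by
    refine exists_rootsNear (fun t => hG.map _) (fun t => (hG.natDegree_map _).trans hdeg)
      (fun t k => ?_) fun t x hx => by simpa using hroots _ _ (hspec t) x hx
    simp only [hP, coeff_map, evalAt_apply]
    exact AnalyticAt.fun_comp ((G.coeff k).2 _ (exp_mem_sphere t)) (by fun_prop)
  obtain ⟨nu, σ, hnu, hσ⟩ := exists_rootsNear_periodic hlocal Real.two_pi_pos hPper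
  have hcyc : ∀ i j, σ.SameCycle i j := sameCycle_of_irreducible hirr hG
    (fun i t => (hnu t).1 i) (fun t => (hnu t).2.self_of_nhds) hσ
  have hon : σ.IsCycleOn (Finset.univ : Finset (Fin d)) :=
    ⟨by simp, fun i _ j _ => hcyc i j⟩
  set i₀ : Fin d := ⟨0, hd0⟩
  have hiter : ∀ (n : ℕ) (i : Fin d) (t : ℂ), nu i (t + n * (2 * Real.pi)) = nu ((σ ^ n) i) t := by
    intro n
    induction n with
    | zero => intro i t; simp
    | succ n ih =>
      intro i t
      have h1 : t + ((n + 1 : ℕ) : ℂ) * (2 * Real.pi) =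
          t + n * (2 * Real.pi) + (2 * Real.pi : ℝ) := by push_cast; ring
      rw [h1, hσ, ih, ← Equiv.Perm.mul_apply, ← pow_succ]
  have hd' : (d : ℂ) ≠ 0 := Nat.cast_ne_zero.2 hd0.ne'
  -- Replacing `s` by `s + 2π` translates `d * s` by `d` periods, which acts by `σ ^ d`, and this
  -- fixes `i₀`.
  have hfper : ∀ t : ℂ, (fun s => nu i₀ (d * s)) (t + (2 * Real.pi : ℝ)) =
      (fun s => nu i₀ (d * s)) t := fun t => by
    have h1 : (σ ^ d) i₀ = i₀ := by
      simpa using hon.pow_card_apply (Finset.mem_univ i₀)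
    have h2 : (d : ℂ) * (t + (2 * Real.pi : ℝ)) = d * t + d * (2 * Real.pi) := by push_cast; ring
    simp only [h2, hiter, h1]
  refine ⟨circ fun s => nu i₀ (d * s), analyticOnNhd_circ hfper fun t => ?_, fun z => ?_⟩
  · refine AnalyticAt.fun_comp ?_ (by fun_prop)
    have := (hnu (d * t)).1 i₀
    push_cast at this
    exact this
  obtain ⟨t, ht⟩ := exists_eq_exp z
  have hz : z = Circle.exp t := Circle.ext (by rw [Circle.coe_exp, ht])
  -- The `d` roots `ζ` of `ζ ^ d = z` correspond to `d` successive translates of `nu i₀`, which run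
  -- through the whole cycle of `σ`.
  have hbij : Function.Bijective fun k : Fin d => (σ ^ (k : ℕ)) i₀ := by
    rw [← Finite.surjective_iff_bijective]
    intro j
    obtain ⟨n, hn, hj⟩ := hon.exists_pow_eq (Finset.mem_univ i₀) (Finset.mem_univ j)
    exact ⟨⟨n, by simpa using hn⟩, hj⟩
  have key : ∏ ζ ∈ nthRootsFinset d (z : ℂ), (X - C (circ (fun s => nu i₀ (d * s)) ζ)) = P t := by
    rw [ht, prod_nthRootsFinset_exp hd0.ne', (hnu t).2.self_of_nhds,
      ← hbij.prod_comp fun j => X - C (nu j t)]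
    refine Finset.prod_congr rfl fun k _ => ?_
    rw [circ_exp hfper, mul_div_cancel₀ _ hd', hiter]
  rw [key, hz]
  exact hspec t

theorem IsEigenfunction.exists_eq_rotate {g : QT[X]} {d : ℕ} (hd : d ≠ 0) {lam lam' : ℂ → ℂ}
    (h : IsEigenfunction g d lam) (h' : IsEigenfunction g d lam') :
    ∃ c : ℕ, c < d ∧ ∀ ζ : Circle,
      lam' (ζ : ℂ) = lam (Complex.exp (2 * Real.pi * Complex.I * c / d) * ζ) := by
  have hd' : (d : ℂ) ≠ 0 := Nat.cast_ne_zero.2 hd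
  obtain ⟨σ, hσ⟩ := exists_perm_of_frequently_eq (z := (0 : ℝ)) (d := d)
    (fun k => analyticAt_comp_exp h'.1 d k 0) (fun k => analyticAt_comp_exp h.1 d k 0) (by
      rw [Complex.ofReal_zero]
      refine tendsto_ofReal_nhdsNE_zero.frequently (Eventually.frequently
        (Eventually.of_forall fun t => ?_))
      rw [← prod_nthRootsFinset_exp hd fun ζ => X - C (lam' ζ),
        ← prod_nthRootsFinset_exp hd fun ζ => X - C (lam ζ), ← Circle.coe_exp]
      exact (h'.2 _).unique (h.2 _))
  set k₀ : Fin d := ⟨0, Nat.pos_of_ne_zero hd⟩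
  -- The branch of `lam'` with index `0` is matched with the branch of `lam` with index `c`, whose
  -- argument carries the extra factor `exp (2πi c / d)`.
  set c : Fin d := σ k₀ with hc
  refine ⟨c, c.2, fun ζ => ?_⟩
  have hrot : Complex.exp (2 * Real.pi * Complex.I * c / d) ∈ Metric.sphere (0 : ℂ) 1 := by
    have := exp_mem_sphere (2 * Real.pi * c / d)
    push_cast at this
    convert this using 2
    ring
  have hanal : AnalyticOnNhd ℂ
      (fun w => lam (Complex.exp (2 * Real.pi * Complex.I * c / d) * w)) (Metric.sphere 0 1) :=
    fun w hw => AnalyticAt.fun_comp (h.1 _ (by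
      rw [mem_sphere_zero_iff_norm] at hw hrot ⊢
      rw [norm_mul, hw, hrot, mul_one])) (by fun_prop)
  refine h'.1.eqOn_of_preconnected_of_frequently_eq hanal isPreconnected_sphere
    (z₀ := 1) (by simp) ?_ (coe_mem_sphere ζ)
  -- The arc `exp (I / d * t)` passes through `1` at `t = 0`; agreement along it suffices for the
  -- identity theorem on the connected circle.
  have htend := tendsto_exp_nhdsNE 0 (div_ne_zero Complex.I_ne_zero hd')
  rw [Complex.ofReal_zero, mul_zero, Complex.exp_zero] at htend
  refine htend.frequently (Eventually.frequently ?_)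
  filter_upwards [tendsto_ofReal_nhdsNE_zero.eventually
    ((hσ k₀).filter_mono (by rw [Complex.ofReal_zero]; exact nhdsWithin_le_nhds))] with t ht
  simp only [k₀, Nat.cast_zero, zero_mul, add_zero] at ht
  have e1 : Complex.I / d * t = t / d * Complex.I := by ring
  rw [e1, ht, ← Complex.exp_add]
  congr 2
  ring

end MeroCircle

theorem mainTheorem7 (g : Polynomial MeroCircle.QT) (d : ℕ)
    (hirr : Irreducible g) (hmonic : g.Monic) (hdeg : g.natDegree = d)
    (hroots : ∀ (z : Circle) (p : Polynomial ℂ), MeroCircle.SpecializesTo g z p →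
      ∀ x : ℂ, p.IsRoot x → x ∈ Metric.sphere (0 : ℂ) 1) :
    (∃ lam : ℂ → ℂ, MeroCircle.IsEigenfunction g d lam) ∧
    ∀ lam lam' : ℂ → ℂ, MeroCircle.IsEigenfunction g d lam →
      MeroCircle.IsEigenfunction g d lam' →
      ∃ c : ℕ, c < d ∧ ∀ ζ : Circle,
        lam' (ζ : ℂ) = lam (Complex.exp (2 * Real.pi * Complex.I * c / d) * ζ) := by
  subst hdeg
  exact ⟨MeroCircle.exists_isEigenfunction hirr hmonic hroots, fun _ _ h h' =>
    h.exists_eq_rotate (hmonic.natDegree_pos_of_not_isUnit hirr.not_isUnit).ne' h'⟩
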